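/- Let $1\le d\le n$ and let $M\subset\mathbb R^n$ be an (embedded) $C^2$ submanifold of dimension $d$ with $0\in M$. Denote by $T$ the orthogonal projector onto the tangent space $T_0M$, by $S=S_y$ the orthogonal projector onto $T_yM$ for $y\in M$, and put $T^\perp=\mathrm{Id}-T$, $S^\perp=\mathrm{Id}-S$. Let $H(0,M)$ be the mean curvature vector of $M$ at $0$, that is, the trace of the second fundamental form of $M$ at $0$. Let $\rho,\xi:[0,\infty)\to[0,\infty)$ be smooth functions supported on $[0,1]$ and not identically zero, and let $$C_\rho=d\,\omega_d\int_0^1\rho(t)t^{d-1}\,dt,\qquad C_\xi=d\,\omega_d\int_0^1\xi(t)t^{d-1}\,dt,$$ where $\omega_d$ is the volume of the unit ball of $\mathbb R^d$. For $\varepsilon>0$ and a family $\Pi=(\Pi_y)_{y\in M}$ of linear operators on $\mathbb R^n$ let $$H_\varepsilon^\Pi=-\frac{C_\xi}{C_\rho\,\varepsilon}\;\frac{\displaystyle\int_M\rho'\!\left(\frac{|y|}{\varepsilon}\right)\Pi_y\!\left(\frac{y}{|y|}\right)d\mathcal H^d(y)}{\displaystyle\int_M\xi\!\left(\frac{|y|}{\varepsilon}\right)d\mathcal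 H^d(y)} .$$ Then for all sufficiently small $\varepsilon>0$ the denominator is positive and the integral in the numerator exists for each $\Pi$ listed below, and $$\lim_{\varepsilon\to0^+}H_\varepsilon^\Pi=H(0,M)\quad\text{for }\Pi\in\{\,2S^\perp\circ T^\perp,\;S\circ T,\;-S^\perp\circ T\,\},$$ $$\lim_{\varepsilon\to0^+}H_\varepsilon^\Pi=0\quad\text{for }\Pi\in\{\,T,\;T\circ S,\;S\circ T^\perp,\;T\circ S^\perp\,\}.$$ -/

import Mathlib

open Set Filter MeasureTheory
open scoped Topology ContDiff

noncomputable section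

/-- `M` is an (embedded) `C²` submanifold of dimension `d` of `ℝⁿ`: near each of its points, a `C²`
diffeomorphism `Φ` between open subsets of `ℝⁿ` straightens `M` to a `d`-dimensional linear
subspace. -/
def IsC2Submanifold {n : ℕ} (d : ℕ) (M : Set (EuclideanSpace ℝ (Fin n))) : Prop :=
  ∀ x ∈ M, ∃ (Φ : OpenPartialHomeomorph (EuclideanSpace ℝ (Fin n)) (EuclideanSpace ℝ (Fin n)))
    (L : Submodule ℝ (EuclideanSpace ℝ (Fin n))),
    x ∈ Φ.source ∧ ContDiffOn ℝ 2 Φ Φ.source ∧ ContDiffOn ℝ 2 Φ.symm Φ.target ∧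
    Module.finrank ℝ L = d ∧ ∀ y ∈ Φ.source, (y ∈ M ↔ Φ y ∈ L)

/-- The tangent space of `M` at `x`: the span of the limits of `cₖ (yₖ - x)` with `yₖ ∈ M`,
`yₖ → x` and `cₖ ∈ ℝ`. -/
def tanSpace {n : ℕ} (M : Set (EuclideanSpace ℝ (Fin n))) (x : EuclideanSpace ℝ (Fin n)) :
    Submodule ℝ (EuclideanSpace ℝ (Fin n)) :=
  Submodule.span ℝ (tangentConeAt ℝ M x)

/-- The orthogonal projector of `ℝⁿ` onto the tangent space of `M` at `x`. -/
def tanProj {n : ℕ} (M : Set (EuclideanSpace ℝ (Fin n))) (x : EuclideanSpace ℝ (Fin n)) :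
    EuclideanSpace ℝ (Fin n) →L[ℝ] EuclideanSpace ℝ (Fin n) :=
  (tanSpace M x).starProjection

/-- The orthogonal projector of `ℝⁿ` onto the normal space of `M` at `x`. -/
def norProj {n : ℕ} (M : Set (EuclideanSpace ℝ (Fin n))) (x : EuclideanSpace ℝ (Fin n)) :
    EuclideanSpace ℝ (Fin n) →L[ℝ] EuclideanSpace ℝ (Fin n) :=
  (tanSpace M x)ᗮ.starProjection

/-- The second fundamental form `B(u, v) = (D_u V)^⊥` of `M` at `x`, for `u`, `v` tangent to `M` at
`x`, where `V` is the tangent vector field `y ↦ tanProj M y v` on `M`, which extends `v`. A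
derivative within `M` is determined in the directions tangent to `M`. -/
def secondFundForm {n : ℕ} (M : Set (EuclideanSpace ℝ (Fin n)))
    (x u v : EuclideanSpace ℝ (Fin n)) : EuclideanSpace ℝ (Fin n) :=
  norProj M x (fderivWithin ℝ (fun y => tanProj M y v) M x u)

/-- The mean curvature vector of `M` at `x`: the trace of the second fundamental form. -/
def meanCurvature {n : ℕ} (M : Set (EuclideanSpace ℝ (Fin n))) (x : EuclideanSpace ℝ (Fin n)) :
    EuclideanSpace ℝ (Fin n) :=
  ∑ i, secondFundForm M x (stdOrthonormalBasis ℝ (tanSpace M x) i)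
    (stdOrthonormalBasis ℝ (tanSpace M x) i)

/-- Smooth non-negative functions on `ℝ⁺ = [0, ∞)`, supported on `[0, 1]` and not identically zero.
Values at negative arguments play no role. -/
structure IsKernel (ρ : ℝ → ℝ) : Prop where
  smooth : ContDiffOn ℝ ∞ ρ (Ici 0)
  nonneg : ∀ t, 0 ≤ t → 0 ≤ ρ t
  supported : ∀ t, 1 < t → ρ t = 0
  nontrivial : ∃ t, 0 ≤ t ∧ ρ t ≠ 0

/-- `C_ρ = d ω_d ∫₀¹ ρ(t) t^{d-1} dt`, with `ω_d` the volume of the unit ball of `ℝᵈ`. -/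
def kernelConst (d : ℕ) (ρ : ℝ → ℝ) : ℝ :=
  d * volume.real (Metric.ball (0 : EuclideanSpace ℝ (Fin d)) 1) *
    ∫ t in (0 : ℝ)..1, ρ t * t ^ (d - 1)

/-- The mollified mass `(ξ_ε ∗ μ)(x) = ε^{-d} ∫ ξ(|y - x| / ε) dμ(y)`. -/
def mollifiedMass {n : ℕ} (d : ℕ) (ξ : ℝ → ℝ) (μ : Measure (EuclideanSpace ℝ (Fin n)))
    (x : EuclideanSpace ℝ (Fin n)) (ε : ℝ) : ℝ :=
  (ε ^ d)⁻¹ * ∫ y, ξ (‖y - x‖ / ε) ∂μ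

/-- The integrand `ρ'(|y - x| / ε) Π_y((y - x) / |y - x|)`. -/
def curvatureIntegrand {n : ℕ} (ρ : ℝ → ℝ)
    (P : EuclideanSpace ℝ (Fin n) → EuclideanSpace ℝ (Fin n) →L[ℝ] EuclideanSpace ℝ (Fin n))
    (x : EuclideanSpace ℝ (Fin n)) (ε : ℝ) (y : EuclideanSpace ℝ (Fin n)) :
    EuclideanSpace ℝ (Fin n) :=
  derivWithin ρ (Ici 0) (‖y - x‖ / ε) • P y (‖y - x‖⁻¹ • (y - x))

/-- The approximate mean curvature
`H_ε^Π(x) = - C_ξ / (C_ρ ε) · ∫ ρ'(|y-x|/ε) Π_y((y-x)/|y-x|) dμ(y) / (ε^d (ξ_ε ∗ μ)(x))`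
of a `d`-varifold with weight measure `μ`. -/
def approxMeanCurvature {n : ℕ} (d : ℕ) (ρ ξ : ℝ → ℝ) (μ : Measure (EuclideanSpace ℝ (Fin n)))
    (P : EuclideanSpace ℝ (Fin n) → EuclideanSpace ℝ (Fin n) →L[ℝ] EuclideanSpace ℝ (Fin n))
    (x : EuclideanSpace ℝ (Fin n)) (ε : ℝ) : EuclideanSpace ℝ (Fin n) :=
  -(kernelConst d ξ / (kernelConst d ρ * ε)) •
    (ε ^ d * mollifiedMass d ξ μ x ε)⁻¹ • ∫ y, curvatureIntegrand ρ P x ε y ∂μ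

/-- The weight measure `ℋᵈ ⌞ M` of the varifold associated with a `d`-dimensional submanifold `M`;
`μHE[d]` is the `d`-dimensional Hausdorff measure with the Euclidean normalization. -/
def weightMeasure {n : ℕ} (d : ℕ) (M : Set (EuclideanSpace ℝ (Fin n))) :
    Measure (EuclideanSpace ℝ (Fin n)) :=
  (μHE[d] : Measure (EuclideanSpace ℝ (Fin n))).restrict M

end

/-! Near `0`, `M` is the graph of a `C²` map over its tangent space, parametrized by `φ x = ι x +
B(x, x)/2 + o(|x|²)`, where `B` is the second fundamental form read through the isometry `ι` onto
`T₀M`. The tangent projectors satisfy `S = T + D_x + o(|x|)` at `y = φ x`, and `D_x (ι x) = B(x, x)`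
is normal. Hence each listed operator satisfies `Π_y y = c • ι x + b(x, x) + o(|x|²)`, with `b = B`
for the first three and `b = 0` for the other four (the `hasQuadraticExpansion_*` lemmas). The
factor 2 in `2 S^⊥ T^⊥` compensates the Taylor factor 1/2; the other two curvature operators see the
tilt of the tangent space directly.

The integral over `M` may be replaced by one over `ℝᵈ` because the normal part of the graph enters
lengths only through Pythagoras: `|φ x| = |x| + O(|x|³)`, and `ℋᵈ` on the graph differs from
Lebesgue measure by a relative error `O(ε²)`. The total error is `o(ε^(d+1))`
(`tendsto_integral_sub_integral`). No area formula is needed: the orthogonal projection is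
1-Lipschitz, `φ` is `(1 + Cε²)`-Lipschitz, and these two facts squeeze the measure.

On `ℝᵈ` the linear term is odd and integrates to zero. By rotational symmetry the quadratic term
contributes `tr b / d` times `∫ ρ'(|x|)|x|`, which integration by parts turns into `-d C_ρ`
(`integral_modelIntegrand`). Since the mollified mass tends to `C_ξ`, the constants cancel and the
limit is `tr b`: either `H(0, M)` or `0`. -/

/-! ### Charts and tangent spaces -/

lemma Submodule.tangentConeAt_eq {E : Type*} [NormedAddCommGroup E] [NormedSpace ℝ E]
    [FiniteDimensional ℝ E] (L : Submodule ℝ E) {x : E} (hx : x ∈ L) :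
    tangentConeAt ℝ (L : Set E) x = L := by
  ext y
  constructor
  · intro h
    obtain ⟨α, l, hl, c, d, -, hd, hlim⟩ := exists_fun_of_mem_tangentConeAt h
    have : IsClosed (L : Set E) := L.closed_of_finiteDimensional
    refine this.mem_of_tendsto hlim (hd.mono fun k hk => ?_)
    have : d k ∈ L := by simpa using L.sub_mem hk hx
    exact L.smul_mem _ this
  · intro h
    have := mem_tangentConeAt_of_segment_subset (x := x) (y := x + y)
      (L.convex.segment_subset hx (L.add_mem hx h))
    simpa using this

lemma OpenPartialHomeomorph.exists_continuousLinearEquiv_hasFDerivAt {E F : Type*}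
    [NormedAddCommGroup E] [NormedSpace ℝ E] [NormedAddCommGroup F] [NormedSpace ℝ F]
    (Φ : OpenPartialHomeomorph E F) {x : E} (hx : x ∈ Φ.source)
    (h : DifferentiableAt ℝ Φ x) (h' : DifferentiableAt ℝ Φ.symm (Φ x)) :
    ∃ A : E ≃L[ℝ] F, HasFDerivAt Φ (A : E →L[ℝ] F) x ∧
      HasFDerivAt Φ.symm (A.symm : F →L[ℝ] E) (Φ x) := by
  have h1 : (fderiv ℝ Φ.symm (Φ x)).comp (fderiv ℝ Φ x) = ContinuousLinearMap.id ℝ E := by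
    refine HasFDerivAt.unique (h'.hasFDerivAt.comp x h.hasFDerivAt) ?_
    refine (hasFDerivAt_id x).congr_of_eventuallyEq ?_
    filter_upwards [Φ.open_source.mem_nhds hx] with y hy using Φ.left_inv hy
  have h2 : (fderiv ℝ Φ x).comp (fderiv ℝ Φ.symm (Φ x)) = ContinuousLinearMap.id ℝ F := by
    have h0 : HasFDerivAt Φ (fderiv ℝ Φ x) (Φ.symm (Φ x)) := by
      rw [Φ.left_inv hx]; exact h.hasFDerivAt
    refine HasFDerivAt.unique (h0.comp (Φ x) h'.hasFDerivAt) ?_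
    refine (hasFDerivAt_id (Φ x)).congr_of_eventuallyEq ?_
    filter_upwards [Φ.open_target.mem_nhds (Φ.map_source hx)] with y hy using Φ.right_inv hy
  refine ⟨ContinuousLinearEquiv.equivOfInverse _ _ (fun v => DFunLike.congr_fun h1 v)
    (fun v => DFunLike.congr_fun h2 v), h.hasFDerivAt, h'.hasFDerivAt⟩

/-- The derivatives of `Φ` and `Φ.symm` carry tangent cones into tangent cones in both directions,
so the cone of `M` is exactly `A ⁻¹' L`. It is already a subspace, and taking the span adds nothing.
-/
lemma IsC2Submanifold.exists_chart {n d : ℕ} {M : Set (EuclideanSpace ℝ (Fin n))}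
    (hM : IsC2Submanifold d M) {x : EuclideanSpace ℝ (Fin n)} (hx : x ∈ M) :
    ∃ (Φ : OpenPartialHomeomorph (EuclideanSpace ℝ (Fin n)) (EuclideanSpace ℝ (Fin n)))
      (L : Submodule ℝ (EuclideanSpace ℝ (Fin n)))
      (A : EuclideanSpace ℝ (Fin n) ≃L[ℝ] EuclideanSpace ℝ (Fin n)),
      x ∈ Φ.source ∧ ContDiffOn ℝ 2 Φ Φ.source ∧ (∀ y ∈ Φ.source, (y ∈ M ↔ Φ y ∈ L)) ∧
      HasFDerivAt Φ (A : EuclideanSpace ℝ (Fin n) →L[ℝ] EuclideanSpace ℝ (Fin n)) x ∧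
      Module.finrank ℝ (tanSpace M x) = d ∧ ∀ v, v ∈ tanSpace M x ↔ A v ∈ L := by
  obtain ⟨Φ, L, hxs, hΦ, hΦ', hL, hML⟩ := hM x hx
  have hd : DifferentiableAt ℝ Φ x :=
    (hΦ.contDiffAt (Φ.open_source.mem_nhds hxs)).differentiableAt (by norm_num)
  have hd' : DifferentiableAt ℝ Φ.symm (Φ x) :=
    (hΦ'.contDiffAt (Φ.open_target.mem_nhds (Φ.map_source hxs))).differentiableAt (by norm_num)
  obtain ⟨A, hA, hA'⟩ := Φ.exists_continuousLinearEquiv_hasFDerivAt hxs hd hd'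
  have hΦx : Φ x ∈ L := (hML x hxs).1 hx
  have hcone : tangentConeAt ℝ M x = A ⁻¹' L := by
    apply Subset.antisymm
    · intro v hv
      rw [← tangentConeAt_inter_nhds (Φ.open_source.mem_nhds hxs)] at hv
      have h1 := (hA.hasFDerivWithinAt (s := M ∩ Φ.source)).mapsTo_tangent_cone hv
      have h2 : Φ '' (M ∩ Φ.source) ⊆ L := by
        rintro _ ⟨y, hy, rfl⟩
        exact (hML y hy.2).1 hy.1
      have h3 := tangentConeAt_mono (𝕜 := ℝ) (x := Φ x) h2 h1
      rwa [L.tangentConeAt_eq hΦx] at h3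
    · intro v hv
      have hv' : A v ∈ tangentConeAt ℝ ((L : Set _) ∩ Φ.target) (Φ x) := by
        rw [tangentConeAt_inter_nhds (Φ.open_target.mem_nhds (Φ.map_source hxs)),
          L.tangentConeAt_eq hΦx]
        exact hv
      have h1 := (hA'.hasFDerivWithinAt (s := (L : Set _) ∩ Φ.target)).mapsTo_tangent_cone hv'
      have h2 : Φ.symm '' ((L : Set _) ∩ Φ.target) ⊆ M := by
        rintro _ ⟨y, hy, rfl⟩
        refine (hML _ (Φ.map_target hy.2)).2 ?_
        rw [Φ.right_inv hy.2]
        exact hy.1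
      have h3 := tangentConeAt_mono (𝕜 := ℝ) (x := Φ.symm (Φ x)) h2 h1
      rw [Φ.left_inv hxs] at h3
      simpa using h3
  have htan : tanSpace M x = L.comap A.toLinearEquiv.toLinearMap := by
    rw [tanSpace, hcone]
    exact Submodule.span_eq (L.comap A.toLinearEquiv.toLinearMap)
  refine ⟨Φ, L, A, hxs, hΦ, hML, hA, ?_, fun v => by rw [htan]; rfl⟩
  rw [htan, ← hL]
  exact (A.toLinearEquiv.ofSubmodule' L).finrank_eq

/-! ### The submanifold as a graph over its tangent space -/

/-- Near `0`, the set `M` is the graph over the range `T₀M` of the linear isometry `ι` of a `C²`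
function with values in the normal space, parametrized by `φ`. -/
structure IsLocalGraph {n d : ℕ} (M : Set (EuclideanSpace ℝ (Fin n)))
    (ι : EuclideanSpace ℝ (Fin d) →ₗᵢ[ℝ] EuclideanSpace ℝ (Fin n))
    (φ : EuclideanSpace ℝ (Fin d) → EuclideanSpace ℝ (Fin n)) (r : ℝ) : Prop where
  pos : 0 < r
  range_eq : LinearMap.range ι.toLinearMap = tanSpace M 0
  contDiffOn : ContDiffOn ℝ 2 φ (Metric.ball 0 r)
  map_zero : φ 0 = 0
  adjoint_apply : ∀ x ∈ Metric.ball 0 r, ι.toContinuousLinearMap.adjoint (φ x) = x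
  mem : ∀ x ∈ Metric.ball 0 r, φ x ∈ M
  apply_adjoint : ∀ y ∈ M, ‖y‖ < r → φ (ι.toContinuousLinearMap.adjoint y) = y
  hasFDerivAt_zero : HasFDerivAt φ ι.toContinuousLinearMap 0
  range_fderiv : ∀ x ∈ Metric.ball 0 r,
    LinearMap.range (fderiv ℝ φ x).toLinearMap = tanSpace M (φ x)

lemma LinearIsometry.adjoint_apply_apply {E F : Type*} [NormedAddCommGroup E]
    [InnerProductSpace ℝ E] [CompleteSpace E] [NormedAddCommGroup F] [InnerProductSpace ℝ F]
    [CompleteSpace F] (ι : E →ₗᵢ[ℝ] F) (x : E) : ι.toContinuousLinearMap.adjoint (ι x) = x := by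
  refine ext_inner_right ℝ fun v => ?_
  rw [ContinuousLinearMap.adjoint_inner_left]
  exact ι.inner_map_map x v

lemma LinearIsometry.norm_adjoint_le {E F : Type*} [NormedAddCommGroup E]
    [InnerProductSpace ℝ E] [CompleteSpace E] [NormedAddCommGroup F] [InnerProductSpace ℝ F]
    [CompleteSpace F] (ι : E →ₗᵢ[ℝ] F) (y : F) : ‖ι.toContinuousLinearMap.adjoint y‖ ≤ ‖y‖ := by
  refine (ContinuousLinearMap.le_opNorm _ y).trans ?_
  rw [LinearIsometryEquiv.norm_map]
  exact mul_le_of_le_one_left (norm_nonneg y) ι.norm_toContinuousLinearMap_le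

/-- Differentiating curves in `M` gives one inclusion; the left inverse `p` makes the derivative
injective, so dimensions force equality. -/
lemma range_fderiv_eq_tanSpace {n d : ℕ} {M : Set (EuclideanSpace ℝ (Fin n))}
    (hM : IsC2Submanifold d M) {φ : EuclideanSpace ℝ (Fin d) → EuclideanSpace ℝ (Fin n)}
    {x : EuclideanSpace ℝ (Fin d)} {s : Set (EuclideanSpace ℝ (Fin d))} (hs : s ∈ 𝓝 x)
    (hφM : ∀ z ∈ s, φ z ∈ M) (hφ : DifferentiableAt ℝ φ x)
    {p : EuclideanSpace ℝ (Fin n) →L[ℝ] EuclideanSpace ℝ (Fin d)} (hp : ∀ z ∈ s, p (φ z) = z) :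
    LinearMap.range (fderiv ℝ φ x).toLinearMap = tanSpace M (φ x) := by
  have hle : LinearMap.range (fderiv ℝ φ x).toLinearMap ≤ tanSpace M (φ x) := by
    rintro _ ⟨v, rfl⟩
    have hv : v ∈ tangentConeAt ℝ s x := by rw [tangentConeAt_of_mem_nhds hs]; trivial
    have h1 := (hφ.hasFDerivAt.hasFDerivWithinAt (s := s)).mapsTo_tangent_cone hv
    refine Submodule.subset_span (tangentConeAt_mono ?_ h1)
    rintro _ ⟨z, hz, rfl⟩
    exact hφM z hz
  have hinv : p.comp (fderiv ℝ φ x) = ContinuousLinearMap.id ℝ _ := by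
    refine HasFDerivAt.unique (p.hasFDerivAt.comp x hφ.hasFDerivAt) ?_
    refine (hasFDerivAt_id x).congr_of_eventuallyEq ?_
    filter_upwards [hs] with z hz using hp z hz
  have hinj : Function.Injective (fderiv ℝ φ x) :=
    Function.LeftInverse.injective (g := p) fun v => DFunLike.congr_fun hinv v
  refine Submodule.eq_of_le_of_finrank_eq hle ?_
  obtain ⟨-, -, -, -, -, -, -, hfin, -⟩ := hM.exists_chart (hφM x (mem_of_mem_nhds hs))
  rw [LinearMap.finrank_range_of_inj hinj, hfin, finrank_euclideanSpace_fin]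

lemma IsC2Submanifold.exists_isLocalGraph {n d : ℕ} {M : Set (EuclideanSpace ℝ (Fin n))}
    (hM : IsC2Submanifold d M) (h0 : (0 : EuclideanSpace ℝ (Fin n)) ∈ M)
    (ι : EuclideanSpace ℝ (Fin d) →ₗᵢ[ℝ] EuclideanSpace ℝ (Fin n))
    (hι : LinearMap.range ι.toLinearMap = tanSpace M 0) :
    ∃ φ r, IsLocalGraph M ι φ r := by
  obtain ⟨Φ, L, A, h0s, hΦ, hML, hA, -, hAL⟩ := hM.exists_chart h0
  set p := ι.toContinuousLinearMap.adjoint with hp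
  have hpι : ∀ x, p (ι x) = x := ι.adjoint_apply_apply
  set T : EuclideanSpace ℝ (Fin n) →L[ℝ] EuclideanSpace ℝ (Fin n) :=
    ι.toContinuousLinearMap.comp p with hT
  have hTa : ∀ y, T y = ι (p y) := fun y => rfl
  have hTmem : ∀ v, v ∈ tanSpace M 0 ↔ T v = v := by
    intro v
    rw [← hι]
    constructor
    · rintro ⟨x, rfl⟩
      exact congrArg ι (hpι x)
    · intro h
      exact ⟨p v, h⟩
  -- `G` keeps the tangential coordinate of `y` and replaces the normal one by the normal part of
  -- the straightened point. Its derivative at `0` is the identity, and near `0` it sends `M` into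
  -- `T₀M`; the graph map is its local inverse restricted to `T₀M`.
  set G : EuclideanSpace ℝ (Fin n) → EuclideanSpace ℝ (Fin n) := fun y =>
    T y + (ContinuousLinearMap.id ℝ (EuclideanSpace ℝ (Fin n)) - T : _ →L[ℝ] _)
      (A.symm (Φ y - Φ 0)) with hG
  have hΦ0 : Φ 0 ∈ L := (hML 0 h0s).1 h0
  have hG0 : G 0 = 0 := by simp [hG]
  have hGc : ContDiffAt ℝ 2 G 0 := by
    have h1 : ContDiffAt ℝ 2 Φ 0 := hΦ.contDiffAt (Φ.open_source.mem_nhds h0s)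
    have h2 : ContDiffAt ℝ 2 (fun y => Φ y - Φ 0) 0 := h1.sub contDiffAt_const
    exact T.contDiff.contDiffAt.add ((ContinuousLinearMap.contDiff _).contDiffAt.comp 0
      (A.symm.contDiff.contDiffAt.comp 0 h2))
  have hGd : HasFDerivAt G
      ((ContinuousLinearEquiv.refl ℝ (EuclideanSpace ℝ (Fin n)) :
        EuclideanSpace ℝ (Fin n) →L[ℝ] EuclideanSpace ℝ (Fin n))) 0 := by
    have h2 : HasFDerivAt (fun y => Φ y - Φ 0) (A : _ →L[ℝ] _) 0 := hA.sub_const _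
    have h3 := T.hasFDerivAt.add
      (((ContinuousLinearMap.id ℝ (EuclideanSpace ℝ (Fin n)) - T).hasFDerivAt).comp
        (0 : EuclideanSpace ℝ (Fin n)) (A.symm.hasFDerivAt.comp 0 h2))
    refine h3.congr_fderiv ?_
    ext1 v
    simp
  have hpG : ∀ y, p (G y) = p y := by
    intro y
    simp only [hG, map_add, sub_apply, ContinuousLinearMap.id_apply, map_sub,
      hTa, hpι]
    abel
  have hGmem : ∀ y ∈ Φ.source, (y ∈ M ↔ G y = ι (p y)) := by
    intro y hy
    have h1 : Φ y ∈ L ↔ Φ y - Φ 0 ∈ L := (L.sub_mem_iff_left hΦ0).symm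
    rw [hML y hy, h1, ← A.apply_symm_apply (Φ y - Φ 0), ← hAL, hTmem]
    simp only [hG, ← hTa, add_eq_left, sub_apply,
      ContinuousLinearMap.id_apply, sub_eq_zero]
    exact eq_comm
  set e := hGc.toOpenPartialHomeomorph G hGd (by norm_num) with he
  have heG : ∀ y, e y = G y := fun y => rfl
  have h0e : (0 : EuclideanSpace ℝ (Fin n)) ∈ e.source :=
    hGc.mem_toOpenPartialHomeomorph_source hGd (by norm_num)
  have h0t : (0 : EuclideanSpace ℝ (Fin n)) ∈ e.target := by
    have := e.map_source h0e
    rwa [heG, hG0] at this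
  have hes0 : e.symm 0 = 0 := by
    have := e.left_inv h0e
    rwa [heG, hG0] at this
  have hinv : ContDiffAt ℝ 2 e.symm 0 := by
    have := hGc.to_localInverse hGd (by norm_num)
    rw [hG0] at this
    exact this
  have hinvd : HasFDerivAt e.symm
      ((ContinuousLinearEquiv.refl ℝ (EuclideanSpace ℝ (Fin n)) :
        EuclideanSpace ℝ (Fin n) →L[ℝ] EuclideanSpace ℝ (Fin n))) 0 := by
    refine e.hasFDerivAt_symm (f' := ContinuousLinearEquiv.refl ℝ _) h0t ?_
    rw [hes0]
    exact hGd
  -- The last two conditions concern `z` as a point of the ambient space rather than as a value of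
  -- `G`: they are what lets every point of `M` in the ball be recovered from its projection.
  have hev : ∀ᶠ z in 𝓝 (0 : EuclideanSpace ℝ (Fin n)),
      z ∈ e.target ∧ ContDiffAt ℝ 2 e.symm z ∧ e.symm z ∈ Φ.source ∧ z ∈ e.source ∧
      z ∈ Φ.source := by
    refine Filter.Eventually.and (e.open_target.mem_nhds h0t) ((hinv.eventually (by norm_num)).and
      (Filter.Eventually.and ?_ (Filter.Eventually.and (e.open_source.mem_nhds h0e)
        (Φ.open_source.mem_nhds h0s))))
    refine hinv.continuousAt.eventually ?_
    rw [hes0]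
    exact Φ.open_source.mem_nhds h0s
  obtain ⟨r, hr, hball⟩ := Metric.eventually_nhds_iff_ball.1 hev
  have hιball : ∀ x ∈ Metric.ball (0 : EuclideanSpace ℝ (Fin d)) r, ι x ∈ Metric.ball 0 r := by
    intro x hx
    simpa using hx
  have hcd : ∀ x ∈ Metric.ball (0 : EuclideanSpace ℝ (Fin d)) r,
      ContDiffAt ℝ 2 (fun x => e.symm (ι x)) x := fun x hx =>
    (hball _ (hιball x hx)).2.1.comp x ι.contDiff.contDiffAt
  have hGι : ∀ x ∈ Metric.ball (0 : EuclideanSpace ℝ (Fin d)) r, G (e.symm (ι x)) = ι x :=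
    fun x hx => e.right_inv (hball _ (hιball x hx)).1
  have hproj : ∀ x ∈ Metric.ball (0 : EuclideanSpace ℝ (Fin d)) r, p (e.symm (ι x)) = x := by
    intro x hx
    rw [← hpG, hGι x hx, hpι]
  have hmem : ∀ x ∈ Metric.ball (0 : EuclideanSpace ℝ (Fin d)) r, e.symm (ι x) ∈ M := by
    intro x hx
    rw [hGmem _ (hball _ (hιball x hx)).2.2.1, hproj x hx, hGι x hx]
  refine ⟨fun x => e.symm (ι x), r, hr, hι, fun x hx => (hcd x hx).contDiffWithinAt, ?_, hproj,
    hmem, ?_, ?_, ?_⟩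
  · simp [hes0]
  · intro y hy hyr
    have hyb := hball y (by simpa using hyr)
    have := (hGmem y hyb.2.2.2.2).1 hy
    change e.symm (ι (p y)) = y
    rw [← this, ← heG, e.left_inv hyb.2.2.2.1]
  · have h1 : HasFDerivAt e.symm
      ((ContinuousLinearEquiv.refl ℝ (EuclideanSpace ℝ (Fin n)) :
        EuclideanSpace ℝ (Fin n) →L[ℝ] EuclideanSpace ℝ (Fin n))) (ι 0) := by
      rw [ι.map_zero]; exact hinvd
    exact h1.comp 0 ι.toContinuousLinearMap.hasFDerivAt
  · intro x hx
    exact range_fderiv_eq_tanSpace hM (Metric.isOpen_ball.mem_nhds hx) hmem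
      ((hcd x hx).differentiableAt (by norm_num)) hproj

/-- Building `ι` from the very basis used in `meanCurvature` makes independence of the trace from
the basis unnecessary. -/
lemma IsC2Submanifold.exists_linearIsometry {n d : ℕ} {M : Set (EuclideanSpace ℝ (Fin n))}
    (hM : IsC2Submanifold d M) (h0 : (0 : EuclideanSpace ℝ (Fin n)) ∈ M) :
    ∃ ι : EuclideanSpace ℝ (Fin d) →ₗᵢ[ℝ] EuclideanSpace ℝ (Fin n),
      LinearMap.range ι.toLinearMap = tanSpace M 0 ∧
      meanCurvature M 0 = ∑ i, secondFundForm M 0 (ι (EuclideanSpace.single i 1))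
        (ι (EuclideanSpace.single i 1)) := by
  obtain ⟨-, -, -, -, -, -, -, rfl, -⟩ := hM.exists_chart h0
  refine ⟨(tanSpace M 0).subtypeₗᵢ.comp
    (stdOrthonormalBasis ℝ (tanSpace M 0)).repr.symm.toLinearIsometry, ?_, ?_⟩
  · ext v
    constructor
    · rintro ⟨x, rfl⟩
      exact Subtype.property _
    · intro hv
      exact ⟨(stdOrthonormalBasis ℝ (tanSpace M 0)).repr ⟨v, hv⟩, by simp⟩
  · simp [meanCurvature]

/-! ### Smooth dependence of the projector on a parametrization -/

section Projector

variable {E F : Type*} [NormedAddCommGroup E] [InnerProductSpace ℝ E] [FiniteDimensional ℝ E]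
  [CompleteSpace E] [NormedAddCommGroup F] [InnerProductSpace ℝ F] [CompleteSpace F]

lemma ContinuousLinearMap.isUnit_adjoint_comp_self {W : E →L[ℝ] F} (hW : Function.Injective W) :
    IsUnit (W.adjoint.comp W : E →L[ℝ] E) := by
  have hinj : Function.Injective (W.adjoint.comp W : E →L[ℝ] E) := by
    rw [injective_iff_map_eq_zero]
    intro v hv
    have h1 : inner ℝ (W v) (W v) = 0 := by
      rw [← ContinuousLinearMap.adjoint_inner_left]
      change inner ℝ ((W.adjoint.comp W) v) v = 0
      rw [hv, inner_zero_left]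
    exact (map_eq_zero_iff W hW).1 (inner_self_eq_zero.1 h1)
  rw [ContinuousLinearMap.isUnit_iff_bijective]
  exact ⟨hinj, LinearMap.injective_iff_surjective
    (f := (W.adjoint.comp W : E →L[ℝ] E).toLinearMap) |>.1 hinj⟩

/-- These are the normal equations of least squares: `W* (u - W (W*W)⁻¹ W* u) = 0`. The total
function `Ring.inverse` gives an expression defined for every `W` and smooth wherever `W` is
injective. -/
lemma ContinuousLinearMap.starProjection_range_eq [FiniteDimensional ℝ F] {W : E →L[ℝ] F}
    (hW : Function.Injective W) :
    (LinearMap.range W.toLinearMap).starProjection =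
      W.comp ((Ring.inverse (W.adjoint.comp W : E →L[ℝ] E)).comp W.adjoint) := by
  have hunit := ContinuousLinearMap.isUnit_adjoint_comp_self hW
  ext1 u
  refine Submodule.eq_starProjection_of_mem_of_inner_eq_zero ⟨_, rfl⟩ ?_
  rintro _ ⟨w, rfl⟩
  have h1 := DFunLike.congr_fun (Ring.mul_inverse_cancel _ hunit) (W.adjoint u)
  change W.adjoint (W (Ring.inverse (W.adjoint.comp W : E →L[ℝ] E) (W.adjoint u))) =
    W.adjoint u at h1
  change inner ℝ (u - W (Ring.inverse (W.adjoint.comp W : E →L[ℝ] E) (W.adjoint u))) (W w) = 0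
  rw [← ContinuousLinearMap.adjoint_inner_left, map_sub, h1, sub_self, inner_zero_left]

lemma ContinuousLinearMap.contDiffAt_starProjection_formula {W : E →L[ℝ] F}
    (hW : Function.Injective W) :
    ContDiffAt ℝ 1 (fun W : E →L[ℝ] F =>
      W.comp ((Ring.inverse (W.adjoint.comp W : E →L[ℝ] E)).comp W.adjoint)) W := by
  obtain ⟨u, hu⟩ := ContinuousLinearMap.isUnit_adjoint_comp_self hW
  have hadj : ContDiff ℝ 1 (fun W : E →L[ℝ] F => W.adjoint) :=
    (ContinuousLinearMap.adjoint (𝕜 := ℝ) (E := E) (F := F)).contDiff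
  have h1 : ContDiffAt ℝ 1 (fun W : E →L[ℝ] F => (W.adjoint.comp W : E →L[ℝ] E)) W :=
    (hadj.clm_comp contDiff_id).contDiffAt
  have h2 : ContDiffAt ℝ 1 (Ring.inverse : (E →L[ℝ] E) → _) (W.adjoint.comp W) := by
    rw [← hu]; exact contDiffAt_ringInverse ℝ u
  have h3 : ContDiffAt ℝ 1 (fun W : E →L[ℝ] F =>
      Ring.inverse (W.adjoint.comp W : E →L[ℝ] E)) W :=
    ContDiffAt.comp (f := fun W : E →L[ℝ] F => (W.adjoint.comp W : E →L[ℝ] E)) W h2 h1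
  exact contDiffAt_id.clm_comp (h3.clm_comp hadj.contDiffAt)

end Projector

namespace IsLocalGraph

variable {n d : ℕ} {M : Set (EuclideanSpace ℝ (Fin n))}
  {ι : EuclideanSpace ℝ (Fin d) →ₗᵢ[ℝ] EuclideanSpace ℝ (Fin n)}
  {φ : EuclideanSpace ℝ (Fin d) → EuclideanSpace ℝ (Fin n)} {r : ℝ}

lemma ball_mem_nhds (h : IsLocalGraph M ι φ r) :
    Metric.ball (0 : EuclideanSpace ℝ (Fin d)) r ∈ 𝓝 0 := Metric.ball_mem_nhds 0 h.pos

lemma differentiableAt (h : IsLocalGraph M ι φ r) {x : EuclideanSpace ℝ (Fin d)}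
    (hx : x ∈ Metric.ball 0 r) : DifferentiableAt ℝ φ x :=
  (h.contDiffOn.contDiffAt (Metric.isOpen_ball.mem_nhds hx)).differentiableAt (by norm_num)

lemma fderiv_zero (h : IsLocalGraph M ι φ r) : fderiv ℝ φ 0 = ι.toContinuousLinearMap :=
  h.hasFDerivAt_zero.fderiv

lemma adjoint_fderiv (h : IsLocalGraph M ι φ r) {x : EuclideanSpace ℝ (Fin d)}
    (hx : x ∈ Metric.ball 0 r) (v : EuclideanSpace ℝ (Fin d)) :
    ι.toContinuousLinearMap.adjoint (fderiv ℝ φ x v) = v := by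
  have hinv : ι.toContinuousLinearMap.adjoint.comp (fderiv ℝ φ x) =
      ContinuousLinearMap.id ℝ _ := by
    refine HasFDerivAt.unique
      ((ContinuousLinearMap.hasFDerivAt _).comp x (h.differentiableAt hx).hasFDerivAt) ?_
    refine (hasFDerivAt_id x).congr_of_eventuallyEq ?_
    filter_upwards [Metric.isOpen_ball.mem_nhds hx] with z hz using h.adjoint_apply z hz
  exact DFunLike.congr_fun hinv v

lemma contDiffOn_fderiv (h : IsLocalGraph M ι φ r) :
    ContDiffOn ℝ 1 (fderiv ℝ φ) (Metric.ball 0 r) :=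
  h.contDiffOn.fderiv_of_isOpen Metric.isOpen_ball (by norm_num)

lemma contDiffOn_tanProj (h : IsLocalGraph M ι φ r) :
    ContDiffOn ℝ 1 (fun x => tanProj M (φ x)) (Metric.ball 0 r) := by
  have hinj : ∀ x ∈ Metric.ball 0 r, Function.Injective (fderiv ℝ φ x) := fun x hx =>
    Function.LeftInverse.injective (h.adjoint_fderiv hx)
  have h1 : ContDiffOn ℝ 1 (fun x => (fderiv ℝ φ x).comp
      ((Ring.inverse ((fderiv ℝ φ x).adjoint.comp (fderiv ℝ φ x) : _ →L[ℝ] _)).comp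
        (fderiv ℝ φ x).adjoint)) (Metric.ball 0 r) := fun x hx =>
    (ContinuousLinearMap.contDiffAt_starProjection_formula (hinj x hx)).comp_contDiffWithinAt x
      (h.contDiffOn_fderiv x hx)
  refine h1.congr fun x hx => ?_
  rw [tanProj, ← ContinuousLinearMap.starProjection_range_eq (hinj x hx)]
  congr 1
  exact (h.range_fderiv x hx).symm

lemma tanProj_zero_apply (h : IsLocalGraph M ι φ r) (y : EuclideanSpace ℝ (Fin n)) :
    tanProj M 0 y = ι (ι.toContinuousLinearMap.adjoint y) := by
  refine Submodule.eq_starProjection_of_mem_of_inner_eq_zero (K := tanSpace M 0) ?_ ?_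
  · rw [← h.range_eq]; exact ⟨_, rfl⟩
  · rw [← h.range_eq]
    rintro _ ⟨w, rfl⟩
    change inner ℝ _ (ι.toContinuousLinearMap w) = 0
    rw [← ContinuousLinearMap.adjoint_inner_left, map_sub, ι.adjoint_apply_apply, sub_self,
      inner_zero_left]

end IsLocalGraph

lemma norProj_apply {n : ℕ} (M : Set (EuclideanSpace ℝ (Fin n))) (x v : EuclideanSpace ℝ (Fin n)) :
    norProj M x v = v - tanProj M x v :=
  Submodule.starProjection_orthogonal_val v

/-! ### The second fundamental form as the derivative of the tangent projector -/

/-- The derivative at `0` of the tangent projector in graph coordinates. -/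
noncomputable def projDeriv {n d : ℕ} (M : Set (EuclideanSpace ℝ (Fin n)))
    (φ : EuclideanSpace ℝ (Fin d) → EuclideanSpace ℝ (Fin n)) :
    EuclideanSpace ℝ (Fin d) →L[ℝ] EuclideanSpace ℝ (Fin n) →L[ℝ] EuclideanSpace ℝ (Fin n) :=
  fderiv ℝ (fun x => tanProj M (φ x)) 0

namespace IsLocalGraph

variable {n d : ℕ} {M : Set (EuclideanSpace ℝ (Fin n))}
  {ι : EuclideanSpace ℝ (Fin d) →ₗᵢ[ℝ] EuclideanSpace ℝ (Fin n)}
  {φ : EuclideanSpace ℝ (Fin d) → EuclideanSpace ℝ (Fin n)} {r : ℝ}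

lemma hasFDerivAt_tanProj (h : IsLocalGraph M ι φ r) :
    HasFDerivAt (fun x => tanProj M (φ x)) (projDeriv M φ) 0 :=
  ((h.contDiffOn_tanProj.contDiffAt h.ball_mem_nhds).differentiableAt (by norm_num)).hasFDerivAt

lemma tanProj_zero_ι (h : IsLocalGraph M ι φ r) (v : EuclideanSpace ℝ (Fin d)) :
    tanProj M 0 (ι v) = ι v := by
  rw [h.tanProj_zero_apply, ι.adjoint_apply_apply]

/-- Differentiating `S ∘ S = S` at `0` gives `D T + T D = D`; on tangent vectors `T` is the
identity, which leaves `T D = 0`. -/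
lemma tanProj_zero_projDeriv (h : IsLocalGraph M ι φ r) (u v : EuclideanSpace ℝ (Fin d)) :
    tanProj M 0 (projDeriv M φ u (ι v)) = 0 := by
  have h1 := h.hasFDerivAt_tanProj.clm_comp h.hasFDerivAt_tanProj
  have h2 : (fun x => (tanProj M (φ x)).comp (tanProj M (φ x))) = fun x => tanProj M (φ x) := by
    funext x
    exact (tanSpace M (φ x)).isIdempotentElem_starProjection
  rw [h2] at h1
  have h3 := DFunLike.congr_fun (DFunLike.congr_fun (h1.unique h.hasFDerivAt_tanProj) u) (ι v)
  simp only [h.map_zero] at h3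
  simpa [h.tanProj_zero_ι] using h3

lemma hasFDerivAt_fderiv (h : IsLocalGraph M ι φ r) :
    HasFDerivAt (fderiv ℝ φ) (fderiv ℝ (fderiv ℝ φ) 0) 0 :=
  ((h.contDiffOn_fderiv.contDiffAt h.ball_mem_nhds).differentiableAt (by norm_num)).hasFDerivAt

/-- Differentiate `S (Dφ(x) v) = Dφ(x) v` at `0`: this gives `D_u (ι v) + T (D²φ(u, v)) = D²φ(u,
v)`. The middle term vanishes because the tangential part of `Dφ(x) v` is constant in `x`. -/
lemma fderiv_fderiv_eq_projDeriv (h : IsLocalGraph M ι φ r) (u v : EuclideanSpace ℝ (Fin d)) :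
    fderiv ℝ (fderiv ℝ φ) 0 u v = projDeriv M φ u (ι v) := by
  have h1 := h.hasFDerivAt_fderiv.clm_apply (hasFDerivAt_const v (0 : EuclideanSpace ℝ (Fin d)))
  have h2 := (ContinuousLinearMap.hasFDerivAt ι.toContinuousLinearMap.adjoint).comp
    (0 : EuclideanSpace ℝ (Fin d)) h1
  have h3 : HasFDerivAt (fun _ : EuclideanSpace ℝ (Fin d) => v)
      (0 : EuclideanSpace ℝ (Fin d) →L[ℝ] EuclideanSpace ℝ (Fin d)) 0 := hasFDerivAt_const _ _
  have h4 := h2.unique (h3.congr_of_eventuallyEq (by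
    filter_upwards [h.ball_mem_nhds] with x hx using h.adjoint_fderiv hx v))
  have h5 := DFunLike.congr_fun h4 u
  have h6 : ι.toContinuousLinearMap.adjoint (fderiv ℝ (fderiv ℝ φ) 0 u v) = 0 := by
    simpa using h5
  have h7 := h.hasFDerivAt_tanProj.clm_apply h1
  have h8 := h7.unique (h1.congr_of_eventuallyEq (by
    filter_upwards [h.ball_mem_nhds] with x hx
    refine Submodule.starProjection_eq_self_iff.2 ?_
    rw [← h.range_fderiv x hx]
    exact ⟨v, rfl⟩))
  have h9 := DFunLike.congr_fun h8 u
  simp only [h.map_zero, h.fderiv_zero] at h9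
  simp [h.tanProj_zero_apply, h6] at h9
  exact h9.symm

lemma secondFundForm_eq (h : IsLocalGraph M ι φ r) (u v : EuclideanSpace ℝ (Fin d)) :
    secondFundForm M 0 (ι u) (ι v) = projDeriv M φ u (ι v) := by
  set p := ι.toContinuousLinearMap.adjoint
  have h1 : HasFDerivAt (fun y => tanProj M (φ (p y))) ((projDeriv M φ).comp p) 0 := by
    have h2 : HasFDerivAt (fun x => tanProj M (φ x)) (projDeriv M φ) (p 0) := by
      rw [p.map_zero]; exact h.hasFDerivAt_tanProj
    exact h2.comp 0 p.hasFDerivAt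
  have h3 := (h1.clm_apply
    (hasFDerivAt_const (ι v) (0 : EuclideanSpace ℝ (Fin n)))).hasFDerivWithinAt (s := M)
  have h4 : HasFDerivWithinAt (fun y => tanProj M y (ι v)) _ M 0 :=
    HasFDerivWithinAt.congr_of_eventuallyEq h3 (by
      filter_upwards [self_mem_nhdsWithin, mem_nhdsWithin_of_mem_nhds
        (Metric.ball_mem_nhds (0 : EuclideanSpace ℝ (Fin n)) h.pos)] with y hy hyr
      rw [h.apply_adjoint y hy (by simpa using hyr)]) (by
      change tanProj M 0 (ι v) = tanProj M (φ (p 0)) (ι v)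
      rw [p.map_zero, h.map_zero])
  -- `fderivWithin` is only one possible derivative within `M`. Any two agree on the tangent cone,
  -- hence by linearity on its span, which contains `ι u`.
  have h5 := h4.differentiableWithinAt.hasFDerivWithinAt.unique_on h4
  have h6 : fderivWithin ℝ (fun y => tanProj M y (ι v)) M 0 (ι u) = projDeriv M φ u (ι v) := by
    have h7 := LinearMap.eqOn_span
      (f := (fderivWithin ℝ (fun y => tanProj M y (ι v)) M 0).toLinearMap)
      (g := ContinuousLinearMap.toLinearMap _) h5
    have h8 := h7 (x := ι u) (by
      change ι u ∈ tanSpace M 0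
      rw [← h.range_eq]; exact ⟨u, rfl⟩)
    refine h8.trans ?_
    simp [p, ι.adjoint_apply_apply]
  rw [secondFundForm, h6, norProj_apply, h.tanProj_zero_projDeriv, sub_zero]

end IsLocalGraph

/-! ### Second order expansions of the seven operators -/

/-- The mean value inequality is applied to the remainder along the segment `t ↦ t • x`, where
differentiability of `fderiv ℝ f` at `0` bounds its derivative by `c ‖x‖²`. -/
lemma isLittleO_taylor_two {E F : Type*} [NormedAddCommGroup E] [NormedSpace ℝ E]
    [NormedAddCommGroup F] [NormedSpace ℝ F] {f : E → F} {f'' : E →L[ℝ] E →L[ℝ] F}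
    (hf : ∀ᶠ x in 𝓝 (0 : E), DifferentiableAt ℝ f x) (hf'' : HasFDerivAt (fderiv ℝ f) f'' 0) :
    (fun x => f x - f 0 - fderiv ℝ f 0 x - (1 / 2 : ℝ) • f'' x x) =o[𝓝 0]
      fun x => ‖x‖ ^ 2 := by
  rw [Asymptotics.isLittleO_iff]
  intro c hc
  have h1 := (Asymptotics.isLittleO_iff.1 hf''.isLittleO) hc
  obtain ⟨δ, hδ, hball⟩ := Metric.eventually_nhds_iff_ball.1 (hf.and h1)
  filter_upwards [Metric.ball_mem_nhds (0 : E) hδ] with x hx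
  have htx : ∀ t ∈ Icc (0 : ℝ) 1, t • x ∈ Metric.ball (0 : E) δ := by
    intro t ht
    rw [mem_ball_zero_iff] at hx ⊢
    rw [norm_smul, Real.norm_of_nonneg ht.1]
    exact (mul_le_of_le_one_left (norm_nonneg x) ht.2).trans_lt hx
  have hder : ∀ t ∈ Icc (0 : ℝ) 1, HasDerivWithinAt
      (fun t : ℝ => f (t • x) - t • fderiv ℝ f 0 x - (t ^ 2 / 2) • f'' x x)
      (fderiv ℝ f (t • x) x - fderiv ℝ f 0 x - t • f'' x x) (Icc 0 1) t := by
    intro t ht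
    refine HasDerivAt.hasDerivWithinAt ?_
    have e1 : HasDerivAt (fun t : ℝ => t • x) x t := by
      simpa using (hasDerivAt_id t).smul_const x
    have e2 : HasDerivAt (fun t : ℝ => f (t • x)) (fderiv ℝ f (t • x) x) t :=
      (hball _ (htx t ht)).1.hasFDerivAt.comp_hasDerivAt t e1
    have e3 : HasDerivAt (fun t : ℝ => t • fderiv ℝ f 0 x) (fderiv ℝ f 0 x) t := by
      simpa using (hasDerivAt_id t).smul_const (fderiv ℝ f 0 x)
    have e4 : HasDerivAt (fun t : ℝ => (t ^ 2 / 2) • f'' x x) (t • f'' x x) t := by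
      have : HasDerivAt (fun t : ℝ => t ^ 2 / 2) t t := by
        simpa using (hasDerivAt_pow 2 t).div_const 2
      exact this.smul_const _
    exact (e2.sub e3).sub e4
  have hbound : ∀ t ∈ Ico (0 : ℝ) 1,
      ‖fderiv ℝ f (t • x) x - fderiv ℝ f 0 x - t • f'' x x‖ ≤ c * ‖x‖ ^ 2 := by
    intro t ht
    have h2 := (hball _ (htx t (Ico_subset_Icc_self ht))).2
    have h3 : fderiv ℝ f (t • x) x - fderiv ℝ f 0 x - t • f'' x x =
        (fderiv ℝ f (t • x) - fderiv ℝ f 0 - f'' (t • x - 0)) x := by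
      simp
    rw [h3]
    refine (ContinuousLinearMap.le_opNorm _ _).trans ?_
    calc _ ≤ (c * ‖t • x - 0‖) * ‖x‖ := by gcongr
      _ ≤ (c * ‖x‖) * ‖x‖ := by
          gcongr
          rw [sub_zero, norm_smul, Real.norm_of_nonneg ht.1]
          exact mul_le_of_le_one_left (norm_nonneg x) ht.2.le
      _ = c * ‖x‖ ^ 2 := by ring
  have h4 := norm_image_sub_le_of_norm_deriv_le_segment_01' hder hbound
  have h5 : f x - f 0 - fderiv ℝ f 0 x - (1 / 2 : ℝ) • f'' x x =
      (f ((1 : ℝ) • x) - (1 : ℝ) • fderiv ℝ f 0 x - ((1 : ℝ) ^ 2 / 2) • f'' x x) -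
      (f ((0 : ℝ) • x) - (0 : ℝ) • fderiv ℝ f 0 x - ((0 : ℝ) ^ 2 / 2) • f'' x x) := by
    simp; abel
  rw [h5]
  refine h4.trans (le_of_eq ?_)
  simp

/-- The second order expansion `Π_y y = c x + b(x, x) + o(|x|²)` at `y = φ x`. -/
structure HasQuadraticExpansion {n d : ℕ}
    (ι : EuclideanSpace ℝ (Fin d) →ₗᵢ[ℝ] EuclideanSpace ℝ (Fin n))
    (φ : EuclideanSpace ℝ (Fin d) → EuclideanSpace ℝ (Fin n)) (r : ℝ)
    (P : EuclideanSpace ℝ (Fin n) → EuclideanSpace ℝ (Fin n) →L[ℝ] EuclideanSpace ℝ (Fin n))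
    (c : ℝ) (b : EuclideanSpace ℝ (Fin d) →L[ℝ] EuclideanSpace ℝ (Fin d) →L[ℝ]
      EuclideanSpace ℝ (Fin n)) : Prop where
  continuousOn : ContinuousOn (fun x => P (φ x) (φ x)) (Metric.ball 0 r)
  isLittleO : (fun x => P (φ x) (φ x) - c • ι x - b x x) =o[𝓝 0] fun x => ‖x‖ ^ 2

namespace IsLocalGraph

variable {n d : ℕ} {M : Set (EuclideanSpace ℝ (Fin n))}
  {ι : EuclideanSpace ℝ (Fin d) →ₗᵢ[ℝ] EuclideanSpace ℝ (Fin n)}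
  {φ : EuclideanSpace ℝ (Fin d) → EuclideanSpace ℝ (Fin n)} {r : ℝ}

lemma isLittleO_tanProj (h : IsLocalGraph M ι φ r) :
    (fun x => tanProj M (φ x) - tanProj M 0 - projDeriv M φ x) =o[𝓝 0] fun x => ‖x‖ := by
  have := h.hasFDerivAt_tanProj.isLittleO
  simp only [h.map_zero, sub_zero] at this
  exact this.norm_right

lemma isLittleO_graph (h : IsLocalGraph M ι φ r) :
    (fun x => φ x - ι x - (1 / 2 : ℝ) • projDeriv M φ x (ι x)) =o[𝓝 0] fun x => ‖x‖ ^ 2 := by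
  have h1 := isLittleO_taylor_two (f := φ) (by
    filter_upwards [h.ball_mem_nhds] with x hx using h.differentiableAt hx) h.hasFDerivAt_fderiv
  simpa only [h.map_zero, sub_zero, h.fderiv_zero, h.fderiv_fderiv_eq_projDeriv,
    LinearIsometry.coe_toContinuousLinearMap] using h1

lemma isBigO_projDeriv (M : Set (EuclideanSpace ℝ (Fin n)))
    (ι : EuclideanSpace ℝ (Fin d) →ₗᵢ[ℝ] EuclideanSpace ℝ (Fin n))
    (φ : EuclideanSpace ℝ (Fin d) → EuclideanSpace ℝ (Fin n)) :
    (fun x => projDeriv M φ x (ι x)) =O[𝓝 0] fun x => ‖x‖ ^ 2 := by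
  refine Asymptotics.IsBigO.of_bound ‖projDeriv M φ‖ (Eventually.of_forall fun x => ?_)
  refine ((projDeriv M φ).le_opNorm₂ x (ι x)).trans (le_of_eq ?_)
  rw [ι.norm_map]
  simp [sq, mul_assoc]

lemma isBigO_graph (h : IsLocalGraph M ι φ r) :
    (fun x => φ x - ι x) =O[𝓝 0] fun x => ‖x‖ ^ 2 := by
  have h1 := h.isLittleO_graph.isBigO.add
    ((isBigO_projDeriv M ι φ).const_smul_left (1 / 2 : ℝ))
  simpa using h1

lemma tanProj_zero_graph (h : IsLocalGraph M ι φ r) {x : EuclideanSpace ℝ (Fin d)}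
    (hx : x ∈ Metric.ball 0 r) : tanProj M 0 (φ x) = ι x := by
  rw [h.tanProj_zero_apply, h.adjoint_apply x hx]

/-- The projector onto the tangent space at `φ x` nearly annihilates the normal part of `φ x`. -/
lemma isLittleO_tanProj_normal (h : IsLocalGraph M ι φ r) :
    (fun x => tanProj M (φ x) (φ x - ι x)) =o[𝓝 0] fun x => ‖x‖ ^ 2 := by
  have h1 : (fun x => tanProj M (φ x) - tanProj M 0) =o[𝓝 0] fun _ => (1 : ℝ) := by
    rw [Asymptotics.isLittleO_one_iff]
    have h2 := h.hasFDerivAt_tanProj.continuousAt.tendsto.sub_const (tanProj M 0)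
    rwa [h.map_zero, sub_self] at h2
  have h3 : (fun x => (tanProj M (φ x) - tanProj M 0) (φ x - ι x)) =o[𝓝 0]
      fun x => ‖x‖ ^ 2 := by
    have h4 := h1.norm_left.mul_isBigO h.isBigO_graph.norm_left
    simp only [one_mul] at h4
    refine Asymptotics.IsLittleO.of_norm_left (Asymptotics.IsBigO.trans_isLittleO ?_ h4)
    refine Asymptotics.IsBigO.of_bound 1 (Eventually.of_forall fun x => ?_)
    simpa using ContinuousLinearMap.le_opNorm (tanProj M (φ x) - tanProj M 0) (φ x - ι x)
  refine h3.congr' ?_ EventuallyEq.rfl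
  filter_upwards [h.ball_mem_nhds] with x hx
  rw [sub_apply, map_sub (tanProj M 0), h.tanProj_zero_graph hx, h.tanProj_zero_ι, sub_self,
    sub_zero]

lemma isLittleO_tanProj_tangent (h : IsLocalGraph M ι φ r) :
    (fun x => tanProj M (φ x) (ι x) - ι x - projDeriv M φ x (ι x)) =o[𝓝 0]
      fun x => ‖x‖ ^ 2 := by
  have h1 : (fun x => ι x) =O[𝓝 0] fun x => ‖x‖ :=
    Asymptotics.IsBigO.of_bound 1 (Eventually.of_forall fun x => by simp)
  have h2 := h.isLittleO_tanProj.norm_left.mul_isBigO h1.norm_left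
  have h3 : (fun x => (tanProj M (φ x) - tanProj M 0 - projDeriv M φ x) (ι x)) =o[𝓝 0]
      fun x => ‖x‖ ^ 2 := by
    simp only [← sq] at h2
    refine Asymptotics.IsLittleO.of_norm_left (Asymptotics.IsBigO.trans_isLittleO ?_ h2)
    refine Asymptotics.IsBigO.of_bound 1 (Eventually.of_forall fun x => ?_)
    simpa using ContinuousLinearMap.le_opNorm
      (tanProj M (φ x) - tanProj M 0 - projDeriv M φ x) (ι x)
  refine h3.congr_left fun x => ?_
  simp only [sub_apply, h.tanProj_zero_ι]

lemma continuousOn (h : IsLocalGraph M ι φ r) : ContinuousOn φ (Metric.ball 0 r) :=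
  h.contDiffOn.continuousOn

lemma continuousOn_tanProj (h : IsLocalGraph M ι φ r) :
    ContinuousOn (fun x => tanProj M (φ x)) (Metric.ball 0 r) :=
  h.contDiffOn_tanProj.continuousOn

/-- `T^⊥ φ(x)` is the height `φ x - ι x`, which is half the second fundamental form up to `o(|x|²)`;
removing its `S`-part changes it negligibly. -/
lemma hasQuadraticExpansion_norProj_norProj (h : IsLocalGraph M ι φ r) :
    HasQuadraticExpansion ι φ r (fun y => (2 : ℝ) • (norProj M y ∘L norProj M 0)) 0
      ((projDeriv M φ).bilinearComp (ContinuousLinearMap.id ℝ _) ι.toContinuousLinearMap) := by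
  have heq : ∀ y z, ((2 : ℝ) • (norProj M y ∘L norProj M 0)) z =
      (2 : ℝ) • ((z - tanProj M 0 z) - tanProj M y (z - tanProj M 0 z)) := fun y z => by
    simp [norProj_apply]
  constructor
  · simp only [heq]
    have := h.continuousOn
    have := h.continuousOn_tanProj
    fun_prop
  · refine (((h.isLittleO_graph.const_smul_left (2 : ℝ)).sub
      (h.isLittleO_tanProj_normal.const_smul_left (2 : ℝ))).congr' ?_ EventuallyEq.rfl)
    filter_upwards [h.ball_mem_nhds] with x hx
    simp only [heq, h.tanProj_zero_graph hx, Pi.smul_apply, ContinuousLinearMap.bilinearComp_apply,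
      ContinuousLinearMap.id_apply, LinearIsometry.coe_toContinuousLinearMap]
    module

lemma hasQuadraticExpansion_tanProj_tanProj_zero (h : IsLocalGraph M ι φ r) :
    HasQuadraticExpansion ι φ r (fun y => tanProj M y ∘L tanProj M 0) 1
      ((projDeriv M φ).bilinearComp (ContinuousLinearMap.id ℝ _) ι.toContinuousLinearMap) := by
  constructor
  · simp only [ContinuousLinearMap.comp_apply]
    have := h.continuousOn
    have := h.continuousOn_tanProj
    fun_prop
  · refine h.isLittleO_tanProj_tangent.congr' ?_ EventuallyEq.rfl
    filter_upwards [h.ball_mem_nhds] with x hx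
    simp [h.tanProj_zero_graph hx]

lemma hasQuadraticExpansion_neg_norProj_tanProj_zero (h : IsLocalGraph M ι φ r) :
    HasQuadraticExpansion ι φ r (fun y => -(norProj M y ∘L tanProj M 0)) 0
      ((projDeriv M φ).bilinearComp (ContinuousLinearMap.id ℝ _) ι.toContinuousLinearMap) := by
  have heq : ∀ y z, (-(norProj M y ∘L tanProj M 0)) z =
      -(tanProj M 0 z - tanProj M y (tanProj M 0 z)) := fun y z => by
    simp [norProj_apply]
  constructor
  · simp only [heq]
    have := h.continuousOn
    have := h.continuousOn_tanProj
    fun_prop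
  · refine h.isLittleO_tanProj_tangent.congr' ?_ EventuallyEq.rfl
    filter_upwards [h.ball_mem_nhds] with x hx
    simp [heq, h.tanProj_zero_graph hx]

lemma hasQuadraticExpansion_tanProj_zero (h : IsLocalGraph M ι φ r) :
    HasQuadraticExpansion ι φ r (fun _ => tanProj M 0) 1 0 := by
  constructor
  · have := h.continuousOn
    fun_prop
  · refine (Asymptotics.isLittleO_zero _ _).congr' ?_ EventuallyEq.rfl
    filter_upwards [h.ball_mem_nhds] with x hx
    simp [h.tanProj_zero_graph hx]

lemma hasQuadraticExpansion_tanProj_zero_tanProj (h : IsLocalGraph M ι φ r) :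
    HasQuadraticExpansion ι φ r (fun y => tanProj M 0 ∘L tanProj M y) 1 0 := by
  constructor
  · simp only [ContinuousLinearMap.comp_apply]
    have := h.continuousOn
    have := h.continuousOn_tanProj
    fun_prop
  -- Adding the two expansions gives `S φ(x) = ι x + D_x (ι x) + o(|x|²)`, and `T` kills the normal
  -- vector `D_x (ι x)`.
  · have h1 := ((tanProj M 0).isBigO_comp _ (𝓝 0)).trans_isLittleO
      (h.isLittleO_tanProj_normal.add h.isLittleO_tanProj_tangent)
    refine h1.congr_left fun x => ?_
    simp [h.tanProj_zero_ι, h.tanProj_zero_projDeriv]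

lemma hasQuadraticExpansion_tanProj_norProj_zero (h : IsLocalGraph M ι φ r) :
    HasQuadraticExpansion ι φ r (fun y => tanProj M y ∘L norProj M 0) 0 0 := by
  constructor
  · simp only [ContinuousLinearMap.comp_apply, norProj_apply]
    have := h.continuousOn
    have := h.continuousOn_tanProj
    fun_prop
  · refine h.isLittleO_tanProj_normal.congr' ?_ EventuallyEq.rfl
    filter_upwards [h.ball_mem_nhds] with x hx
    simp [norProj_apply, h.tanProj_zero_graph hx]

lemma hasQuadraticExpansion_tanProj_zero_norProj (h : IsLocalGraph M ι φ r) :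
    HasQuadraticExpansion ι φ r (fun y => tanProj M 0 ∘L norProj M y) 0 0 := by
  constructor
  · simp only [ContinuousLinearMap.comp_apply, norProj_apply]
    have := h.continuousOn
    have := h.continuousOn_tanProj
    fun_prop
  · refine (h.hasQuadraticExpansion_tanProj_zero.isLittleO.sub
      h.hasQuadraticExpansion_tanProj_zero_tanProj.isLittleO).congr_left fun x => ?_
    simp [norProj_apply]

end IsLocalGraph

/-! ### Hausdorff measure on the graph against Lebesgue measure -/

lemma LipschitzOnWith.euclideanHausdorffMeasure_image_le {X Y : Type*} [EMetricSpace X]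
    [EMetricSpace Y] [MeasurableSpace X] [BorelSpace X] [MeasurableSpace Y] [BorelSpace Y]
    {f : X → Y} {s : Set X} {K : NNReal} (h : LipschitzOnWith K f s) (d : ℕ) :
    μHE[d] (f '' s) ≤ (K : ENNReal) ^ d * μHE[d] s := by
  have h1 := h.hausdorffMeasure_image_le (d := d) (Nat.cast_nonneg d)
  rw [ENNReal.rpow_natCast] at h1
  rw [Measure.euclideanHausdorffMeasure_def, Measure.euclideanHausdorffMeasure_def,
    Measure.smul_apply, Measure.smul_apply, ENNReal.smul_def, ENNReal.smul_def, smul_eq_mul,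
    smul_eq_mul, mul_left_comm]
  gcongr

/-- For ordered measures the difference of integrals is an integral against `nu - lam`, so a bound
on total masses suffices and no density has to be computed. -/
lemma norm_integral_sub_integral_le_of_measure_le {α G : Type*} [MeasurableSpace α]
    [NormedAddCommGroup G] [NormedSpace ℝ G] {lam nu : Measure α} [IsFiniteMeasure lam]
    [IsFiniteMeasure nu] (hle : lam ≤ nu) {g : α → G} (hg : StronglyMeasurable g) {K : ℝ}
    (hK : ∀ x, ‖g x‖ ≤ K) :
    ‖∫ x, g x ∂nu - ∫ x, g x ∂lam‖ ≤ K * (nu.real univ - lam.real univ) := by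
  have hfin : IsFiniteMeasure (nu - lam) := isFiniteMeasure_of_le nu Measure.sub_le
  have hint : ∀ m : Measure α, IsFiniteMeasure m → Integrable g m := fun m _ =>
    Integrable.of_bound hg.aestronglyMeasurable K (Eventually.of_forall hK)
  have h1 : ∫ x, g x ∂nu = ∫ x, g x ∂(nu - lam) + ∫ x, g x ∂lam := by
    rw [← integral_add_measure (hint _ hfin) (hint _ inferInstance),
      Measure.sub_add_cancel_of_le hle]
  have h2 : (nu - lam).real univ = nu.real univ - lam.real univ := by
    rw [Measure.real, Measure.sub_apply MeasurableSet.univ hle,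
      ENNReal.toReal_sub_of_le (hle _) (measure_ne_top _ _)]
    rfl
  rw [h1, add_sub_cancel_right, ← h2]
  exact norm_integral_le_of_norm_le_const (Eventually.of_forall hK)

namespace IsLocalGraph

variable {n d : ℕ} {M : Set (EuclideanSpace ℝ (Fin n))}
  {ι : EuclideanSpace ℝ (Fin d) →ₗᵢ[ℝ] EuclideanSpace ℝ (Fin n)}
  {φ : EuclideanSpace ℝ (Fin d) → EuclideanSpace ℝ (Fin n)} {r : ℝ}

/-- The graph map distorts distances within distance `ε` of the origin only to second order
in `ε`. -/
lemma exists_norm_sub_le (h : IsLocalGraph M ι φ r) :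
    ∃ C, 0 ≤ C ∧ ∃ s, 0 < s ∧ s ≤ r ∧ ∀ ε, 0 ≤ ε → ε < s →
      ∀ x ∈ Metric.closedBall 0 ε, ∀ x' ∈ Metric.closedBall 0 ε,
        ‖φ x - φ x'‖ ≤ (1 + C * ε ^ 2) * ‖x - x'‖ := by
  obtain ⟨C, hC, hbd⟩ := h.hasFDerivAt_fderiv.isBigO_sub.exists_pos
  rw [Asymptotics.isBigOWith_iff] at hbd
  obtain ⟨s, hs, hball⟩ := Metric.eventually_nhds_iff_ball.1 hbd
  refine ⟨C ^ 2, by positivity, min s r, lt_min hs h.pos, min_le_right _ _, ?_⟩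
  intro ε hε hεs x hx x' hx'
  have hsub : ∀ z ∈ Metric.closedBall (0 : EuclideanSpace ℝ (Fin d)) ε,
      z ∈ Metric.ball 0 s ∧ z ∈ Metric.ball 0 r := by
    intro z hz
    rw [mem_closedBall_zero_iff] at hz
    simp only [mem_ball_zero_iff]
    exact lt_min_iff.1 (hz.trans_lt hεs)
  have hf : ‖(φ x - ι x) - (φ x' - ι x')‖ ≤ C * ε * ‖x - x'‖ := by
    refine Convex.norm_image_sub_le_of_norm_hasFDerivWithin_le
      (f := fun z => φ z - ι z) (f' := fun z => fderiv ℝ φ z - ι.toContinuousLinearMap)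
      (s := Metric.closedBall 0 ε) ?_ ?_ (convex_closedBall _ _) hx' hx
    · intro z hz
      exact ((h.differentiableAt (hsub z hz).2).hasFDerivAt.sub
        ι.toContinuousLinearMap.hasFDerivAt).hasFDerivWithinAt
    · intro z hz
      have h1 := hball z (hsub z hz).1
      rw [h.fderiv_zero, sub_zero] at h1
      refine h1.trans ?_
      gcongr
      simpa using hz
  -- The increment of the height is normal and has length at most `C ε ‖x - x'‖`. Pythagoras squares
  -- this factor; a distortion linear in `ε` would survive the division by `ε ^ (d + 1)`.
  have horth : inner ℝ (ι (x - x')) ((φ x - ι x) - (φ x' - ι x')) = 0 := by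
    change inner ℝ (ι.toContinuousLinearMap (x - x')) _ = 0
    rw [← ContinuousLinearMap.adjoint_inner_right]
    simp only [map_sub, h.adjoint_apply x (hsub x hx).2, h.adjoint_apply x' (hsub x' hx').2,
      ι.adjoint_apply_apply, sub_self, inner_zero_right]
  have hpyth := norm_add_sq_eq_norm_sq_add_norm_sq_of_inner_eq_zero _ _ horth
  have hsum : ι (x - x') + ((φ x - ι x) - (φ x' - ι x')) = φ x - φ x' := by
    rw [map_sub]; abel
  rw [hsum, ι.norm_map] at hpyth
  refine abs_le_of_sq_le_sq' ?_ (by positivity) |>.2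
  have h2 : ‖(φ x - ι x) - (φ x' - ι x')‖ ^ 2 ≤ (C * ε * ‖x - x'‖) ^ 2 := by gcongr
  nlinarith [sq_nonneg (C ^ 2 * ε ^ 2 * ‖x - x'‖), sq_nonneg (C * ε * ‖x - x'‖)]

lemma norm_le (h : IsLocalGraph M ι φ r) {x : EuclideanSpace ℝ (Fin d)}
    (hx : x ∈ Metric.ball 0 r) : ‖x‖ ≤ ‖φ x‖ := by
  conv_lhs => rw [← h.adjoint_apply x hx]
  exact ι.norm_adjoint_le _

/-- The projection is a 1-Lipschitz left inverse of `φ`, and 1-Lipschitz maps do not increase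
Hausdorff measure. -/
lemma restrict_volume_le_map (h : IsLocalGraph M ι φ r) {ε : ℝ} (hε : ε < r) :
    (volume : Measure (EuclideanSpace ℝ (Fin d))).restrict (Metric.closedBall 0 ε) ≤
      ((μHE[d] : Measure (EuclideanSpace ℝ (Fin n))).restrict
        (φ '' Metric.closedBall 0 ε)).map ι.toContinuousLinearMap.adjoint := by
  set p := ι.toContinuousLinearMap.adjoint
  have hmeas : Measurable p := p.continuous.measurable
  have hsub := Metric.closedBall_subset_ball (x := (0 : EuclideanSpace ℝ (Fin d))) hε
  refine Measure.le_iff.2 fun A hA => ?_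
  rw [Measure.restrict_apply hA, Measure.map_apply hmeas hA,
    Measure.restrict_apply (hmeas hA), ← EuclideanSpace.euclideanHausdorffMeasure_eq_volume]
  have h1 : LipschitzWith 1 p := by
    refine LipschitzWith.of_dist_le_mul fun y z => ?_
    rw [dist_eq_norm, dist_eq_norm, ← map_sub, NNReal.coe_one, one_mul]
    exact ι.norm_adjoint_le _
  have h2 := (h1.lipschitzOnWith (s := p ⁻¹' A ∩ φ '' Metric.closedBall 0 ε)
    ).euclideanHausdorffMeasure_image_le d
  rw [ENNReal.coe_one, one_pow, one_mul] at h2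
  refine le_trans (measure_mono ?_) h2
  rintro x ⟨hxA, hxB⟩
  have hpx := h.adjoint_apply x (hsub hxB)
  exact ⟨φ x, ⟨by rwa [mem_preimage, hpx], mem_image_of_mem _ hxB⟩, hpx⟩

lemma euclideanHausdorffMeasure_image_closedBall_le {C ε : ℝ} (hC : 0 ≤ C)
    (hlip : ∀ x ∈ Metric.closedBall 0 ε, ∀ x' ∈ Metric.closedBall 0 ε,
        ‖φ x - φ x'‖ ≤ (1 + C * ε ^ 2) * ‖x - x'‖) :
    (μHE[d] : Measure (EuclideanSpace ℝ (Fin n))) (φ '' Metric.closedBall 0 ε) ≤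
      ENNReal.ofReal ((1 + C * ε ^ 2) ^ d) *
        volume (Metric.closedBall (0 : EuclideanSpace ℝ (Fin d)) ε) := by
  have h1 : LipschitzOnWith (Real.toNNReal (1 + C * ε ^ 2)) φ (Metric.closedBall 0 ε) := by
    refine LipschitzOnWith.of_dist_le_mul fun x hx x' hx' => ?_
    rw [Real.coe_toNNReal _ (by positivity), dist_eq_norm, dist_eq_norm]
    exact hlip x hx x' hx'
  have h2 := h1.euclideanHausdorffMeasure_image_le d
  rw [EuclideanSpace.euclideanHausdorffMeasure_eq_volume] at h2
  rwa [ENNReal.ofReal_pow (by positivity)]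

/-- Comparison of an integral over `M` near `0` with an integral over the tangent space. -/
lemma norm_integral_sub_integral_le {G : Type*} [NormedAddCommGroup G] [NormedSpace ℝ G]
    (h : IsLocalGraph M ι φ r) {C ε δ K : ℝ} (hC : 0 ≤ C) (hε : ε < r)
    (hlip : ∀ x ∈ Metric.closedBall 0 ε, ∀ x' ∈ Metric.closedBall 0 ε,
        ‖φ x - φ x'‖ ≤ (1 + C * ε ^ 2) * ‖x - x'‖)
    {F : EuclideanSpace ℝ (Fin n) → G} {g : EuclideanSpace ℝ (Fin d) → G}
    (hF0 : ∀ y, ε < ‖y‖ → F y = 0)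
    (hFm : AEStronglyMeasurable F ((μHE[d] : Measure (EuclideanSpace ℝ (Fin n))).restrict
      (φ '' Metric.closedBall 0 ε)))
    (hg : StronglyMeasurable g) (hg0 : ∀ x, ε < ‖x‖ → g x = 0) (hK : ∀ x, ‖g x‖ ≤ K)
    (hδ : ∀ x ∈ Metric.closedBall 0 ε, ‖F (φ x) - g x‖ ≤ δ) :
    Integrable F (weightMeasure d M) ∧
    ‖∫ y, F y ∂(weightMeasure d M) - ∫ x, g x‖ ≤
      (δ * (1 + C * ε ^ 2) ^ d + K * ((1 + C * ε ^ 2) ^ d - 1)) *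
        volume.real (Metric.closedBall (0 : EuclideanSpace ℝ (Fin d)) ε) := by
  set p := ι.toContinuousLinearMap.adjoint
  set B := Metric.closedBall (0 : EuclideanSpace ℝ (Fin d)) ε with hB
  set N := φ '' B with hN
  set m := (μHE[d] : Measure (EuclideanSpace ℝ (Fin n))) with hm
  have hsub : B ⊆ Metric.ball 0 r := Metric.closedBall_subset_ball hε
  have hNmeas : MeasurableSet N :=
    ((isCompact_closedBall 0 ε).image_of_continuousOn (h.continuousOn.mono hsub)).measurableSet
  have hNM : N ⊆ M := by
    rintro _ ⟨x, hx, rfl⟩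
    exact h.mem x (hsub hx)
  -- `N` may protrude from the ball of radius `ε`, since `φ` increases norms; `F` vanishes out
  -- there, so only the parts inside the ball have to coincide.
  have hMN : Metric.closedBall 0 ε ∩ M = Metric.closedBall 0 ε ∩ N := by
    refine Subset.antisymm ?_ (inter_subset_inter_right _ hNM)
    rintro y ⟨hyε, hyM⟩
    rw [mem_closedBall_zero_iff] at hyε
    refine ⟨mem_closedBall_zero_iff.2 hyε, p y, ?_, h.apply_adjoint y hyM (hyε.trans_lt hε)⟩
    rw [hB, mem_closedBall_zero_iff]
    exact (ι.norm_adjoint_le y).trans hyε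
  have hmass := euclideanHausdorffMeasure_image_closedBall_le hC hlip
  have hBfin : volume B ≠ ⊤ := measure_closedBall_lt_top.ne
  have hNfin : m N ≠ ⊤ := ne_top_of_le_ne_top (ENNReal.mul_ne_top ENNReal.ofReal_ne_top hBfin) hmass
  have hmassr : m.real N ≤ (1 + C * ε ^ 2) ^ d * volume.real B := by
    have := ENNReal.toReal_mono (ENNReal.mul_ne_top ENNReal.ofReal_ne_top hBfin) hmass
    rwa [ENNReal.toReal_mul, ENNReal.toReal_ofReal (by positivity)] at this
  have hfinN : IsFiniteMeasure (m.restrict N) := ⟨by simpa using hNfin.lt_top⟩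
  have hFN : ∀ y ∈ N, ‖F y - g (p y)‖ ≤ δ := by
    rintro _ ⟨x, hx, rfl⟩
    rw [h.adjoint_apply x (hsub hx)]
    exact hδ x hx
  have hintF : Integrable F (m.restrict N) := by
    refine Integrable.of_bound hFm (δ + K) ?_
    refine (ae_restrict_mem hNmeas).mono fun y hy => ?_
    calc ‖F y‖ = ‖(F y - g (p y)) + g (p y)‖ := by rw [sub_add_cancel]
      _ ≤ δ + K := (norm_add_le _ _).trans (add_le_add (hFN y hy) (hK _))
  have hF0' : ∀ y, y ∉ Metric.closedBall 0 ε → F y = 0 := fun y hy =>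
    hF0 y (by simpa using hy)
  have hrest : ((weightMeasure d M).restrict (Metric.closedBall 0 ε)) =
      (m.restrict N).restrict (Metric.closedBall 0 ε) := by
    rw [weightMeasure, Measure.restrict_restrict Metric.isClosed_closedBall.measurableSet,
      Measure.restrict_restrict Metric.isClosed_closedBall.measurableSet, hMN]
  have hintW : Integrable F (weightMeasure d M) := by
    rw [← integrableOn_iff_integrable_of_support_subset
      (s := Metric.closedBall 0 ε) (fun y hy => by_contra fun hy' => hy (hF0' y hy')),
      IntegrableOn, hrest]
    exact hintF.restrict
  refine ⟨hintW, ?_⟩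
  have hWN : ∫ y, F y ∂(weightMeasure d M) = ∫ y, F y ∂(m.restrict N) := by
    rw [← setIntegral_eq_integral_of_forall_compl_eq_zero hF0', hrest,
      setIntegral_eq_integral_of_forall_compl_eq_zero hF0']
  set nu := (m.restrict N).map p with hnu
  have hpm : Measurable p := p.continuous.measurable
  have hnufin : IsFiniteMeasure nu := Measure.isFiniteMeasure_map _ _
  have hgint : Integrable (fun y => g (p y)) (m.restrict N) :=
    Integrable.of_bound (hg.comp_measurable hpm).aestronglyMeasurable K
      (Eventually.of_forall fun y => hK _)
  have hgnu : ∫ y, g (p y) ∂(m.restrict N) = ∫ x, g x ∂nu :=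
    (integral_map hpm.aemeasurable hg.aestronglyMeasurable).symm
  have hgB : ∫ x, g x = ∫ x in B, g x :=
    (setIntegral_eq_integral_of_forall_compl_eq_zero fun x hx =>
      hg0 x (by simpa [hB] using hx)).symm
  have hnuu : nu.real univ = m.real N := by
    simp [Measure.real, hnu, Measure.map_apply hpm MeasurableSet.univ]
  have hBfin' : IsFiniteMeasure (volume.restrict B) := ⟨by simpa using hBfin.lt_top⟩
  have hcmp := norm_integral_sub_integral_le_of_measure_le (h.restrict_volume_le_map hε) hg hK
  have hK0 : 0 ≤ K := (norm_nonneg _).trans (hK 0)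
  have hfirst : ‖∫ y, F y ∂(m.restrict N) - ∫ y, g (p y) ∂(m.restrict N)‖ ≤ δ * m.real N := by
    rw [← integral_sub hintF hgint]
    have := norm_integral_le_of_norm_le_const (μ := m.restrict N)
      (f := fun y => F y - g (p y)) (C := δ) ((ae_restrict_mem hNmeas).mono hFN)
    simpa [Measure.real] using this
  have hsecond : ‖∫ x, g x ∂nu - ∫ x in B, g x‖ ≤
      K * ((1 + C * ε ^ 2) ^ d * volume.real B - volume.real B) := by
    refine hcmp.trans ?_
    have hBr : (volume.restrict B).real univ = volume.real B := by simp [Measure.real]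
    rw [hBr]
    change K * (nu.real univ - _) ≤ _
    rw [hnuu]
    gcongr
  -- The sign of `δ` is known only when the ball is nonempty; otherwise both sides are zero.
  have hfirst' : δ * m.real N ≤ δ * ((1 + C * ε ^ 2) ^ d * volume.real B) := by
    by_cases hε0 : 0 ≤ ε
    · have : 0 ≤ δ := (norm_nonneg _).trans (hδ 0 (by simpa [hB] using hε0))
      gcongr
    · have : B = ∅ := Metric.closedBall_eq_empty.2 (not_le.1 hε0)
      simp [hN, this]
  rw [hWN, hgB]
  calc _ = ‖(∫ y, F y ∂(m.restrict N) - ∫ y, g (p y) ∂(m.restrict N)) +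
        (∫ x, g x ∂nu - ∫ x in B, g x)‖ := by rw [hgnu]; congr 1; abel
    _ ≤ _ := (norm_add_le _ _).trans (add_le_add (hfirst.trans hfirst') hsecond)
    _ = _ := by ring

end IsLocalGraph

/-! ### Radial profiles and kernels -/

/-- Continuously differentiable functions on `[0, ∞)`, supported on `[0, 1]`. -/
structure IsRadialProfile (w : ℝ → ℝ) : Prop where
  contDiffOn : ContDiffOn ℝ 1 w (Ici 0)
  supported : ∀ t, 1 < t → w t = 0

namespace IsRadialProfile

variable {w : ℝ → ℝ}

lemma exists_bound (hw : IsRadialProfile w) : ∃ K, 0 ≤ K ∧ ∀ t, 0 ≤ t → |w t| ≤ K := by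
  obtain ⟨K, hK⟩ := isCompact_Icc.exists_bound_of_continuousOn
    (hw.contDiffOn.continuousOn.mono (fun t (ht : t ∈ Icc (0 : ℝ) 1) => ht.1))
  have hK0 : 0 ≤ K := (norm_nonneg _).trans (hK 0 (by simp))
  refine ⟨K, hK0, fun t ht => ?_⟩
  rcases le_or_gt t 1 with h | h
  · exact hK t ⟨ht, h⟩
  · rw [hw.supported t h, abs_zero]
    exact hK0

/-- The range reaches 2 because `‖φ x‖ / ε` can exceed 1 when `‖x‖ ≤ ε`. -/
lemma exists_lipschitz (hw : IsRadialProfile w) :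
    ∃ L, 0 ≤ L ∧ ∀ s t, 0 ≤ s → s ≤ 2 → 0 ≤ t → t ≤ 2 → |w s - w t| ≤ L * |s - t| := by
  obtain ⟨L, hL⟩ := (hw.contDiffOn.mono (fun t (ht : t ∈ Icc (0 : ℝ) 2) => ht.1)
    ).exists_lipschitzOnWith one_ne_zero (convex_Icc 0 2) isCompact_Icc
  exact ⟨L, L.2, fun s t hs hs' ht ht' => hL.dist_le_mul s ⟨hs, hs'⟩ t ⟨ht, ht'⟩⟩

lemma continuous_comp_norm (hw : IsRadialProfile w) {E : Type*} [NormedAddCommGroup E] {ε : ℝ}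
    (hε : 0 < ε) : Continuous fun x : E => w (‖x‖ / ε) :=
  hw.contDiffOn.continuousOn.comp_continuous (by fun_prop) fun x => by
    rw [mem_Ici]; positivity

lemma apply_one (hw : IsRadialProfile w) : w 1 = 0 := by
  have h1 : Tendsto w (𝓝[>] 1) (𝓝 (w 1)) :=
    (hw.contDiffOn.continuousOn 1 (by simp)).tendsto.mono_left
      (nhdsWithin_mono _ fun t ht => mem_Ici.2 (le_trans zero_le_one (le_of_lt ht)))
  have h2 : Tendsto w (𝓝[>] 1) (𝓝 0) := by
    refine tendsto_const_nhds.congr' ?_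
    filter_upwards [self_mem_nhdsWithin] with t ht using (hw.supported t ht).symm
  exact tendsto_nhds_unique h1 h2

end IsRadialProfile

namespace IsKernel

variable {ρ : ℝ → ℝ}

lemma isRadialProfile (hρ : IsKernel ρ) : IsRadialProfile ρ :=
  ⟨hρ.smooth.of_le (by exact_mod_cast le_top), hρ.supported⟩

lemma isRadialProfile_derivWithin (hρ : IsKernel ρ) :
    IsRadialProfile (derivWithin ρ (Ici 0)) := by
  refine ⟨hρ.smooth.derivWithin (uniqueDiffOn_Ici 0) (by norm_cast), fun t ht => ?_⟩
  have h1 : ρ =ᶠ[𝓝[Ici 0] t] fun _ => 0 := by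
    filter_upwards [mem_nhdsWithin_of_mem_nhds (Ioi_mem_nhds ht)] with s hs
      using hρ.supported s hs
  rw [h1.derivWithin_eq (hρ.supported t ht)]
  simp

lemma hasDerivWithinAt (hρ : IsKernel ρ) {t : ℝ} (ht : 0 ≤ t) :
    HasDerivWithinAt ρ (derivWithin ρ (Ici 0) t) (Ici 0) t :=
  ((hρ.smooth.differentiableOn (by simp)) t ht).hasDerivWithinAt

lemma kernelConst_pos (hρ : IsKernel ρ) {d : ℕ} (hd : 1 ≤ d) : 0 < kernelConst d ρ := by
  have hball : 0 < volume.real (Metric.ball (0 : EuclideanSpace ℝ (Fin d)) 1) :=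
    ENNReal.toReal_pos (Metric.measure_ball_pos _ _ one_pos).ne' measure_ball_lt_top.ne
  have hd' : (0 : ℝ) < d := by exact_mod_cast hd
  refine mul_pos (mul_pos hd' hball) (intervalIntegral.integral_pos one_pos ?_ ?_ ?_)
  · exact (hρ.smooth.continuousOn.mono Icc_subset_Ici_self).mul (by fun_prop)
  · intro t ht
    exact mul_nonneg (hρ.nonneg t ht.1.le) (pow_nonneg ht.1.le _)
  · obtain ⟨t, ht, hne⟩ := hρ.nontrivial
    have hpos : 0 < ρ t := lt_of_le_of_ne (hρ.nonneg t ht) (Ne.symm hne)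
    -- The point `t` may be `0`, where the weight `t ^ (d - 1)` can vanish; continuity provides a
    -- point slightly to its right.
    have hcont : Tendsto ρ (𝓝[>] t) (𝓝 (ρ t)) :=
      (hρ.smooth.continuousOn t ht).tendsto.mono_left
        (nhdsWithin_mono _ fun s hs => le_trans ht (le_of_lt hs))
    obtain ⟨s, hs, hst⟩ := ((hcont.eventually (lt_mem_nhds hpos)).and self_mem_nhdsWithin).exists
    have hs0 : 0 < s := ht.trans_lt hst
    have hs1 : s ≤ 1 := by
      by_contra hcon
      rw [hρ.supported s (not_le.1 hcon)] at hs
      exact lt_irrefl _ hs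
    exact ⟨s, ⟨hs0.le, hs1⟩, mul_pos hs (pow_pos hs0 _)⟩

end IsKernel

/-! ### Integrals against radial weights -/

section Radial

variable {d : ℕ}

lemma integral_norm_eq_interval (hd : 1 ≤ d) {w : ℝ → ℝ} (hw : ∀ t, 1 < t → w t = 0) :
    ∫ x : EuclideanSpace ℝ (Fin d), w ‖x‖ =
      d * volume.real (Metric.ball (0 : EuclideanSpace ℝ (Fin d)) 1) *
        ∫ t in (0 : ℝ)..1, w t * t ^ (d - 1) := by
  have : Nonempty (Fin d) := ⟨⟨0, hd⟩⟩
  rw [integral_fun_norm_addHaar, finrank_euclideanSpace_fin,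
    intervalIntegral.integral_of_le zero_le_one, nsmul_eq_mul, smul_eq_mul, mul_assoc]
  congr 2
  rw [← integral_indicator measurableSet_Ioi, ← integral_indicator measurableSet_Ioc]
  congr 1
  ext t
  by_cases h0 : 0 < t
  · by_cases h1 : t ≤ 1
    · simp [indicator, h0, h1, mul_comm]
    · simp [indicator, h0, h1, hw t (not_le.1 h1)]
  · simp [indicator, h0]

lemma IsKernel.integral_norm (hd : 1 ≤ d) {ξ : ℝ → ℝ} (hξ : IsKernel ξ) :
    ∫ x : EuclideanSpace ℝ (Fin d), ξ ‖x‖ = kernelConst d ξ :=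
  integral_norm_eq_interval hd hξ.supported

lemma IsKernel.integral_derivWithin_mul_norm (hd : 1 ≤ d) {ρ : ℝ → ℝ} (hρ : IsKernel ρ) :
    ∫ x : EuclideanSpace ℝ (Fin d), derivWithin ρ (Ici 0) ‖x‖ * ‖x‖ =
      -(d * kernelConst d ρ) := by
  have hw := hρ.isRadialProfile_derivWithin
  rw [integral_norm_eq_interval (w := fun t => derivWithin ρ (Ici 0) t * t) hd
    (fun t ht => by rw [hw.supported t ht, zero_mul])]
  have h1 : ∀ t : ℝ, derivWithin ρ (Ici 0) t * t * t ^ (d - 1) =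
      t ^ d * derivWithin ρ (Ici 0) t := by
    intro t
    rw [mul_assoc, ← pow_succ', Nat.sub_add_cancel hd, mul_comm]
  simp only [h1]
  have h01 : uIcc (0 : ℝ) 1 ⊆ Ici 0 := by rw [uIcc_of_le zero_le_one]; exact Icc_subset_Ici_self
  have h2 := intervalIntegral.integral_mul_deriv_eq_deriv_mul_of_hasDeriv_right
    (a := 0) (b := 1) (u := fun t : ℝ => t ^ d) (v := ρ) (u' := fun t => d * t ^ (d - 1))
    (v' := derivWithin ρ (Ici 0)) (by fun_prop) (hρ.smooth.continuousOn.mono h01)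
    (fun t _ => (hasDerivAt_pow d t).hasDerivWithinAt)
    (fun t ht => by
      rw [min_eq_left zero_le_one] at ht
      exact (hρ.hasDerivWithinAt ht.1.le).mono fun s hs => ht.1.le.trans (le_of_lt hs))
    (Continuous.intervalIntegrable (by fun_prop) _ _)
    ((hw.contDiffOn.continuousOn.mono h01).intervalIntegrable)
  -- Both boundary terms vanish: `ρ 1 = 0`, and `0 ^ d = 0` since `1 ≤ d`.
  rw [h2, hρ.isRadialProfile.apply_one, kernelConst, zero_pow (by omega)]
  have h3 : ∀ t : ℝ, d * t ^ (d - 1) * ρ t = d * (ρ t * t ^ (d - 1)) := fun t => by ring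
  simp only [h3, intervalIntegral.integral_const_mul]
  ring

/-- The reflection in the `i`-th coordinate preserves the measure and changes the sign of the
integrand. -/
lemma integral_radial_mul_coord_mul_coord_of_ne (u : ℝ → ℝ) {i j : Fin d} (hij : i ≠ j) :
    ∫ x : EuclideanSpace ℝ (Fin d), u ‖x‖ * (x i * x j) = 0 := by
  let R : EuclideanSpace ℝ (Fin d) ≃ₗᵢ[ℝ] EuclideanSpace ℝ (Fin d) :=
    LinearIsometryEquiv.piLpCongrRight 2
      fun k => if k = i then LinearIsometryEquiv.neg ℝ else LinearIsometryEquiv.refl ℝ ℝ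
  have hRi : ∀ x, R x i = -x i := fun x => by simp [R]
  have hRj : ∀ x, R x j = x j := fun x => by simp [R, Ne.symm hij]
  have h1 := R.measurePreserving.integral_comp R.toHomeomorph.measurableEmbedding
    (fun x : EuclideanSpace ℝ (Fin d) => u ‖x‖ * (x i * x j))
  simp only [R.norm_map, hRi, hRj, neg_mul, mul_neg, integral_neg] at h1
  linarith

lemma integral_radial_mul_coord_sq_eq (u : ℝ → ℝ) (i j : Fin d) :
    ∫ x : EuclideanSpace ℝ (Fin d), u ‖x‖ * (x i * x i) =
      ∫ x : EuclideanSpace ℝ (Fin d), u ‖x‖ * (x j * x j) := by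
  let R : EuclideanSpace ℝ (Fin d) ≃ₗᵢ[ℝ] EuclideanSpace ℝ (Fin d) :=
    LinearIsometryEquiv.piLpCongrLeft 2 ℝ ℝ (Equiv.swap i j)
  have hRi : ∀ x, R x i = x j := fun x => by simp [R]
  have h1 := R.measurePreserving.integral_comp R.toHomeomorph.measurableEmbedding
    (fun x : EuclideanSpace ℝ (Fin d) => u ‖x‖ * (x i * x i))
  simp only [R.norm_map, hRi] at h1
  exact h1.symm

/-- The integral of a quadratic form against a radial weight is a multiple of its trace. -/
lemma integral_radial_smul_bilin {F : Type*} [NormedAddCommGroup F] [NormedSpace ℝ F]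
    [CompleteSpace F] (hd : 1 ≤ d) (u : ℝ → ℝ)
    (hu : AEStronglyMeasurable (fun x : EuclideanSpace ℝ (Fin d) => u ‖x‖))
    (hint : Integrable fun x : EuclideanSpace ℝ (Fin d) => u ‖x‖ * ‖x‖ ^ 2)
    (b : EuclideanSpace ℝ (Fin d) →L[ℝ] EuclideanSpace ℝ (Fin d) →L[ℝ] F) :
    ∫ x : EuclideanSpace ℝ (Fin d), u ‖x‖ • b x x =
      ((d : ℝ)⁻¹ * ∫ x : EuclideanSpace ℝ (Fin d), u ‖x‖ * ‖x‖ ^ 2) •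
        ∑ i, b (EuclideanSpace.single i 1) (EuclideanSpace.single i 1) := by
  have hcoord : ∀ i j, Integrable fun x : EuclideanSpace ℝ (Fin d) => u ‖x‖ * (x i * x j) := by
    intro i j
    refine hint.mono (hu.mul (Continuous.aestronglyMeasurable (by fun_prop)))
      (Eventually.of_forall fun x => ?_)
    rw [norm_mul, norm_mul, norm_mul, norm_pow, norm_norm, sq]
    gcongr <;> exact PiLp.norm_apply_le x _
  have hexp : ∀ x : EuclideanSpace ℝ (Fin d), u ‖x‖ • b x x =
      ∑ i, ∑ j, (u ‖x‖ * (x i * x j)) •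
        b (EuclideanSpace.single i 1) (EuclideanSpace.single j 1) := by
    intro x
    have hx : x = ∑ i, x i • EuclideanSpace.single i (1 : ℝ) := by
      have := (EuclideanSpace.basisFun (Fin d) ℝ).sum_repr x
      simpa using this.symm
    have hb : b x x = ∑ i, ∑ j, (x i * x j) •
        b (EuclideanSpace.single i 1) (EuclideanSpace.single j 1) := by
      calc b x x = b (∑ i, x i • EuclideanSpace.single i (1 : ℝ))
            (∑ j, x j • EuclideanSpace.single j (1 : ℝ)) := by rw [← hx]
        _ = _ := by
          simp only [map_sum, map_smul, sum_apply, smul_apply, Finset.smul_sum, smul_smul]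
          exact Finset.sum_comm.trans (by simp only [mul_comm])
    simp only [hb, Finset.smul_sum, smul_smul]
  -- The `d` diagonal integrals are equal by symmetry and sum to the integral of `u ‖x‖ * ‖x‖ ^ 2`.
  have hA : ∀ i : Fin d, ∫ x : EuclideanSpace ℝ (Fin d), u ‖x‖ * (x i * x i) =
      (d : ℝ)⁻¹ * ∫ x : EuclideanSpace ℝ (Fin d), u ‖x‖ * ‖x‖ ^ 2 := by
    intro i
    have h1 : ∫ x : EuclideanSpace ℝ (Fin d), u ‖x‖ * ‖x‖ ^ 2 =
        ∑ j, ∫ x : EuclideanSpace ℝ (Fin d), u ‖x‖ * (x j * x j) := by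
      rw [← integral_finsetSum _ fun j _ => hcoord j j]
      refine integral_congr_ae (Eventually.of_forall fun x => ?_)
      change u ‖x‖ * ‖x‖ ^ 2 = ∑ j, u ‖x‖ * (x j * x j)
      rw [EuclideanSpace.norm_sq_eq, Finset.mul_sum]
      simp only [Real.norm_eq_abs, sq, abs_mul_abs_self]
    rw [h1, Finset.sum_congr rfl fun j _ => integral_radial_mul_coord_sq_eq u j i]
    have hd' : (d : ℝ) ≠ 0 := by positivity
    simp [inv_mul_cancel_left₀ hd']
  simp only [hexp]
  rw [integral_finsetSum _ fun i _ => integrable_finsetSum _ fun j _ => (hcoord i j).smul_const _,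
    Finset.smul_sum]
  refine Finset.sum_congr rfl fun i _ => ?_
  rw [integral_finsetSum _ fun j _ => (hcoord i j).smul_const _, Finset.sum_eq_single i]
  · rw [integral_smul_const, hA]
  · intro j _ hj
    rw [integral_smul_const, integral_radial_mul_coord_mul_coord_of_ne u (Ne.symm hj), zero_smul]
  · simp

end Radial

/-! ### The model integral on the tangent space -/

lemma tendsto_one_add_mul_sq_pow_sub_one_div (C : ℝ) (d : ℕ) :
    Tendsto (fun ε : ℝ => ((1 + C * ε ^ 2) ^ d - 1) / ε) (𝓝[>] 0) (𝓝 0) := by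
  have h1 : HasDerivAt (fun ε : ℝ => (1 + C * ε ^ 2) ^ d) 0 0 := by
    have h0 : HasDerivAt ((fun ε : ℝ => 1 + C * ε ^ 2) ^ d) 0 0 := by
      simpa using (((hasDerivAt_pow 2 (0 : ℝ)).const_mul C).const_add 1).pow d
    exact h0
  have h2 := (hasDerivAt_iff_tendsto_slope_zero.1 h1).mono_left
    (nhdsWithin_mono _ fun t (ht : (0 : ℝ) < t) => ht.ne')
  refine h2.congr fun ε => ?_
  simp [div_eq_inv_mul]

/-- The leading part of the integrand in graph coordinates. -/
noncomputable def modelIntegrand {n d : ℕ}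
    (ι : EuclideanSpace ℝ (Fin d) →ₗᵢ[ℝ] EuclideanSpace ℝ (Fin n)) (w : ℝ → ℝ) (c : ℝ)
    (b : EuclideanSpace ℝ (Fin d) →L[ℝ] EuclideanSpace ℝ (Fin d) →L[ℝ] EuclideanSpace ℝ (Fin n))
    (ε : ℝ) (x : EuclideanSpace ℝ (Fin d)) : EuclideanSpace ℝ (Fin n) :=
  w (‖x‖ / ε) • ‖x‖⁻¹ • (c • ι x + b x x)

section Model

variable {n d : ℕ} {ι : EuclideanSpace ℝ (Fin d) →ₗᵢ[ℝ] EuclideanSpace ℝ (Fin n)} {w : ℝ → ℝ}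
  {c : ℝ} {b : EuclideanSpace ℝ (Fin d) →L[ℝ] EuclideanSpace ℝ (Fin d) →L[ℝ]
    EuclideanSpace ℝ (Fin n)} {ε : ℝ}

lemma stronglyMeasurable_modelIntegrand (hw : IsRadialProfile w) (hε : 0 < ε) :
    StronglyMeasurable (modelIntegrand ι w c b ε) := by
  have h1 : Continuous fun x : EuclideanSpace ℝ (Fin d) => c • ι x + b x x := by fun_prop
  exact (hw.continuous_comp_norm hε).stronglyMeasurable.smul
    ((measurable_norm.inv.stronglyMeasurable).smul h1.stronglyMeasurable)

lemma modelIntegrand_eq_zero (hw : IsRadialProfile w) (hε : 0 < ε) {x : EuclideanSpace ℝ (Fin d)}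
    (hx : ε < ‖x‖) : modelIntegrand ι w c b ε x = 0 := by
  rw [modelIntegrand, hw.supported _ ((one_lt_div hε).2 hx), zero_smul]

lemma norm_smul_add_bilin_le {x : EuclideanSpace ℝ (Fin d)} (hx : ‖x‖ ≤ 1) :
    ‖c • ι x + b x x‖ ≤ (|c| + ‖b‖) * ‖x‖ := by
  have h1 : ‖c • ι x‖ = |c| * ‖x‖ := by rw [norm_smul, ι.norm_map, Real.norm_eq_abs]
  have h2 : ‖b x x‖ ≤ ‖b‖ * ‖x‖ := by
    refine (b.le_opNorm₂ x x).trans ?_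
    rw [mul_assoc]
    gcongr
    exact mul_le_of_le_one_left (norm_nonneg x) hx
  calc _ ≤ ‖c • ι x‖ + ‖b x x‖ := norm_add_le _ _
    _ ≤ _ := by rw [h1, add_mul]; gcongr

/-- The bound is uniform but not small, because `c • ι x / ‖x‖` has norm `|c|`. This is why the
measure distortion itself must be `o(ε)`. -/
lemma norm_modelIntegrand_le (hw : IsRadialProfile w) {K : ℝ} (hK0 : 0 ≤ K)
    (hK : ∀ t, 0 ≤ t → |w t| ≤ K) (hε : 0 < ε) (hε1 : ε ≤ 1) (x : EuclideanSpace ℝ (Fin d)) :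
    ‖modelIntegrand ι w c b ε x‖ ≤ K * (|c| + ‖b‖) := by
  rcases lt_or_ge ε ‖x‖ with hx | hx
  · rw [modelIntegrand_eq_zero hw hε hx, norm_zero]
    positivity
  · have h1 := norm_smul_add_bilin_le (ι := ι) (c := c) (b := b) (hx.trans hε1)
    rw [modelIntegrand, norm_smul, norm_smul, norm_inv, norm_norm]
    refine mul_le_mul (hK _ (by positivity)) ?_ (by positivity) hK0
    calc _ ≤ ‖x‖⁻¹ * ((|c| + ‖b‖) * ‖x‖) := by gcongr
      _ = (|c| + ‖b‖) * (‖x‖⁻¹ * ‖x‖) := by ring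
      _ ≤ (|c| + ‖b‖) * 1 := by
          gcongr
          exact inv_mul_le_one
      _ = _ := mul_one _

lemma integrable_modelIntegrand (hw : IsRadialProfile w) (hε : 0 < ε) (hε1 : ε ≤ 1) :
    Integrable (modelIntegrand ι w c b ε) := by
  obtain ⟨K, hK0, hK⟩ := hw.exists_bound
  rw [← integrableOn_iff_integrable_of_support_subset (s := Metric.closedBall 0 ε)]
  · have hfin : IsFiniteMeasure ((volume : Measure (EuclideanSpace ℝ (Fin d))).restrict
        (Metric.closedBall 0 ε)) := ⟨by simpa using measure_closedBall_lt_top⟩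
    exact Integrable.of_bound (stronglyMeasurable_modelIntegrand hw hε).aestronglyMeasurable _
      (Eventually.of_forall (norm_modelIntegrand_le hw hK0 hK hε hε1))
  · intro x hx
    by_contra hx'
    exact hx (modelIntegrand_eq_zero hw hε (by simpa using hx'))

lemma integral_modelIntegrand (hd : 1 ≤ d) {ρ : ℝ → ℝ} (hρ : IsKernel ρ) (hε : 0 < ε)
    (hε1 : ε ≤ 1) :
    ∫ x, modelIntegrand ι (derivWithin ρ (Ici 0)) c b ε x =
      ε ^ (d + 1) • -(kernelConst d ρ • ∑ i, b (EuclideanSpace.single i 1)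
        (EuclideanSpace.single i 1)) := by
  have hw := hρ.isRadialProfile_derivWithin
  set w := derivWithin ρ (Ici 0)
  have hsplit : ∀ x, modelIntegrand ι w c b ε x =
      modelIntegrand ι w c 0 ε x + modelIntegrand ι w 0 b ε x := by
    intro x
    simp [modelIntegrand, smul_add]
  have hodd : ∫ x, modelIntegrand ι w c 0 ε x = 0 := by
    have h1 := integral_neg_eq_self (modelIntegrand ι w c 0 ε) volume
    have h2 : ∀ x, modelIntegrand ι w c 0 ε (-x) = -modelIntegrand ι w c 0 ε x := by
      intro x
      simp [modelIntegrand]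
    simp only [h2, integral_neg] at h1
    have h3 : (2 : ℝ) • ∫ x, modelIntegrand ι w c 0 ε x = 0 := by
      rw [two_smul]
      nth_rewrite 1 [← h1]
      exact neg_add_cancel _
    exact (smul_eq_zero.1 h3).resolve_left two_ne_zero
  -- The quadratic part is homogeneous of degree one under rescaling; with `ε ^ d` from the change
  -- of variables this produces `ε ^ (d + 1)`.
  have hscale : ∀ x, modelIntegrand ι w 0 b ε x =
      ε • (fun z : EuclideanSpace ℝ (Fin d) => (w ‖z‖ * ‖z‖⁻¹) • b z z) (ε⁻¹ • x) := by
    intro x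
    have hn : ‖ε⁻¹ • x‖ = ‖x‖ / ε := by
      rw [norm_smul, norm_inv, Real.norm_of_nonneg hε.le, div_eq_inv_mul]
    simp only [modelIntegrand, zero_smul, zero_add, hn, map_smul, smul_apply, smul_smul]
    congr 1
    field_simp
  have hcancel : ∀ x : EuclideanSpace ℝ (Fin d), w ‖x‖ * ‖x‖⁻¹ * ‖x‖ ^ 2 = w ‖x‖ * ‖x‖ := by
    intro x
    rcases eq_or_ne x 0 with rfl | hx
    · simp
    · have : ‖x‖ ≠ 0 := norm_ne_zero_iff.2 hx
      field_simp
  have hcont : Continuous fun x : EuclideanSpace ℝ (Fin d) => w ‖x‖ := by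
    simpa using hw.continuous_comp_norm (E := EuclideanSpace ℝ (Fin d)) one_pos
  have hint : Integrable fun x : EuclideanSpace ℝ (Fin d) =>
      (fun t => w t * t⁻¹) ‖x‖ * ‖x‖ ^ 2 := by
    simp only [hcancel]
    refine (hcont.mul continuous_norm).integrable_of_hasCompactSupport ?_
    refine HasCompactSupport.intro (isCompact_closedBall 0 1) fun x hx => ?_
    change w ‖x‖ * ‖x‖ = 0
    rw [hw.supported _ (by simpa using hx), zero_mul]
  have htrace := integral_radial_smul_bilin hd (fun t => w t * t⁻¹)
    ((hcont.measurable.mul measurable_norm.inv).aestronglyMeasurable) hint b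
  simp only [hcancel, w, hρ.integral_derivWithin_mul_norm hd] at htrace
  rw [integral_congr_ae (Eventually.of_forall hsplit),
    integral_add (integrable_modelIntegrand hw hε hε1) (integrable_modelIntegrand hw hε hε1),
    hodd, zero_add, integral_congr_ae (Eventually.of_forall hscale), integral_smul,
    Measure.integral_comp_inv_smul_of_nonneg volume
      (fun z : EuclideanSpace ℝ (Fin d) => (w ‖z‖ * ‖z‖⁻¹) • b z z) hε.le, htrace,
    finrank_euclideanSpace_fin,
    smul_smul, ← pow_succ']
  have hd' : (d : ℝ) ≠ 0 := by positivity
  rw [mul_neg, neg_smul, inv_mul_cancel_left₀ hd']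

end Model

/-! ### Passing from the submanifold to the tangent space -/

namespace IsLocalGraph

variable {n d : ℕ} {M : Set (EuclideanSpace ℝ (Fin n))}
  {ι : EuclideanSpace ℝ (Fin d) →ₗᵢ[ℝ] EuclideanSpace ℝ (Fin n)}
  {φ : EuclideanSpace ℝ (Fin d) → EuclideanSpace ℝ (Fin n)} {r : ℝ}

/-- Integrals over `M` of functions concentrating at `0` at scale `ε` agree, up to an error of order
`o(ε ^ (d + k))`, with integrals over the tangent space, if the integrands agree up to
`o(ε ^ k)`. -/
lemma tendsto_integral_sub_integral {G : Type*} [NormedAddCommGroup G] [NormedSpace ℝ G]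
    (h : IsLocalGraph M ι φ r) {k : ℕ} (hk : k ≤ 1) {F : ℝ → EuclideanSpace ℝ (Fin n) → G}
    {g : ℝ → EuclideanSpace ℝ (Fin d) → G} {K : ℝ} (hK0 : 0 ≤ K)
    (hF0 : ∀ ε, 0 < ε → ∀ y, ε < ‖y‖ → F ε y = 0)
    (hFm : ∀ ε, 0 < ε → ε < r → AEStronglyMeasurable (F ε)
      ((μHE[d] : Measure (EuclideanSpace ℝ (Fin n))).restrict (φ '' Metric.closedBall 0 ε)))
    (hg : ∀ ε, 0 < ε → StronglyMeasurable (g ε))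
    (hg0 : ∀ ε, 0 < ε → ∀ x, ε < ‖x‖ → g ε x = 0)
    (hK : ∀ ε, 0 < ε → ε ≤ 1 → ∀ x, ‖g ε x‖ ≤ K)
    (hFg : ∀ η > 0, ∀ᶠ ε in 𝓝[>] (0 : ℝ), ∀ x ∈ Metric.closedBall 0 ε,
      ‖F ε (φ x) - g ε x‖ ≤ η * ε ^ k) :
    (∀ᶠ ε in 𝓝[>] (0 : ℝ), Integrable (F ε) (weightMeasure d M)) ∧
    Tendsto (fun ε => (ε ^ (d + k))⁻¹ • (∫ y, F ε y ∂(weightMeasure d M) - ∫ x, g ε x))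
      (𝓝[>] 0) (𝓝 0) := by
  obtain ⟨C, hC, s, hs, hsr, hlip⟩ := h.exists_norm_sub_le
  set v₁ := volume.real (Metric.ball (0 : EuclideanSpace ℝ (Fin d)) 1) with hv₁
  have hv₁0 : 0 ≤ v₁ := measureReal_nonneg
  have hsmall : ∀ᶠ ε in 𝓝[>] (0 : ℝ), 0 < ε ∧ ε < s ∧ ε ≤ 1 := by
    filter_upwards [Ioo_mem_nhdsGT (lt_min hs one_pos)] with ε hε
    exact ⟨hε.1, hε.2.trans_le (min_le_left _ _), hε.2.le.trans (min_le_right _ _)⟩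
  have hmain : ∀ η > 0, ∀ᶠ ε in 𝓝[>] (0 : ℝ), Integrable (F ε) (weightMeasure d M) ∧
      ‖(ε ^ (d + k))⁻¹ • (∫ y, F ε y ∂(weightMeasure d M) - ∫ x, g ε x)‖ ≤
        (η * (1 + C * ε ^ 2) ^ d + K * (((1 + C * ε ^ 2) ^ d - 1) / ε)) * v₁ := by
    intro η hη
    filter_upwards [hsmall, hFg η hη] with ε ⟨hε, hεs, hε1⟩ hFε
    obtain ⟨hint, hle⟩ := h.norm_integral_sub_integral_le hC (hεs.trans_le hsr)
      (hlip ε hε.le hεs) (hF0 ε hε) (hFm ε hε (hεs.trans_le hsr)) (hg ε hε) (hg0 ε hε)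
      (hK ε hε hε1) hFε
    refine ⟨hint, ?_⟩
    have hvol : volume.real (Metric.closedBall (0 : EuclideanSpace ℝ (Fin d)) ε) = ε ^ d * v₁ := by
      rw [Measure.addHaar_real_closedBall _ _ hε.le, finrank_euclideanSpace_fin]
    rw [hvol] at hle
    rw [norm_smul, norm_inv, Real.norm_of_nonneg (by positivity : (0 : ℝ) ≤ ε ^ (d + k))]
    have hone : 1 ≤ (1 + C * ε ^ 2) ^ d := one_le_pow₀ (by nlinarith [mul_nonneg hC (sq_nonneg ε)])
    -- As `k ≤ 1`, the distortion error divided by `ε ^ k` is at most its quotient by `ε`, which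
    -- tends to zero.
    have hεk : ε ≤ ε ^ k := by
      calc ε = ε ^ 1 := (pow_one ε).symm
        _ ≤ ε ^ k := pow_le_pow_of_le_one hε.le hε1 hk
    calc _ ≤ (ε ^ (d + k))⁻¹ * ((η * ε ^ k * (1 + C * ε ^ 2) ^ d +
          K * ((1 + C * ε ^ 2) ^ d - 1)) * (ε ^ d * v₁)) := by gcongr
      _ = (η * (1 + C * ε ^ 2) ^ d + K * (((1 + C * ε ^ 2) ^ d - 1) / ε ^ k)) * v₁ := by
          rw [pow_add]; field_simp
      _ ≤ _ := by
          gcongr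
  refine ⟨(hmain 1 one_pos).mono fun ε hε => hε.1, ?_⟩
  rw [NormedAddGroup.tendsto_nhds_zero]
  intro η hη
  -- With this tolerance the limit is `η v₁ / (2 (v₁ + 1)) < η`; the `+ 1` keeps the denominator
  -- positive from `0 ≤ v₁` alone.
  have hlim : Tendsto (fun ε : ℝ => (η / (2 * (v₁ + 1)) * (1 + C * ε ^ 2) ^ d +
      K * (((1 + C * ε ^ 2) ^ d - 1) / ε)) * v₁) (𝓝[>] 0)
      (𝓝 ((η / (2 * (v₁ + 1)) * 1 + K * 0) * v₁)) := by
    refine ((Tendsto.const_mul _ ?_).add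
      ((tendsto_one_add_mul_sq_pow_sub_one_div C d).const_mul K)).mul_const v₁
    have hc : Continuous fun ε : ℝ => (1 + C * ε ^ 2) ^ d := by fun_prop
    simpa using (hc.tendsto 0).mono_left (nhdsWithin_le_nhds (s := Ioi 0))
  have hlt : (η / (2 * (v₁ + 1)) * 1 + K * 0) * v₁ < η := by
    have : η / (2 * (v₁ + 1)) * v₁ = η * (v₁ / (2 * (v₁ + 1))) := by ring
    rw [mul_one, mul_zero, add_zero, this]
    have h1 : v₁ / (2 * (v₁ + 1)) < 1 := by
      rw [div_lt_one (by positivity)]; linarith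
    nlinarith
  filter_upwards [hmain (η / (2 * (v₁ + 1))) (by positivity), hlim.eventually (gt_mem_nhds hlt)]
    with ε h1 h2
  exact h1.2.trans_lt h2

/-- Near `0`, the norm of a point of the graph exceeds that of its projection by a third order
term. -/
lemma exists_norm_le (h : IsLocalGraph M ι φ r) :
    ∃ C, 0 ≤ C ∧ ∀ᶠ ε in 𝓝[>] (0 : ℝ), ∀ x ∈ Metric.closedBall 0 ε,
      ‖x‖ ≤ ‖φ x‖ ∧ ‖φ x‖ - ‖x‖ ≤ C * ‖x‖ ^ 3 ∧ ‖x‖ / ε ≤ 2 ∧ ‖φ x‖ / ε ≤ 2 := by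
  obtain ⟨C, hC, s, hs, hsr, hlip⟩ := h.exists_norm_sub_le
  refine ⟨C, hC, ?_⟩
  have hsq : ∀ᶠ ε in 𝓝[>] (0 : ℝ), C * ε ^ 2 < 1 := by
    have hc : Continuous fun ε : ℝ => C * ε ^ 2 := by fun_prop
    have := (hc.tendsto 0).mono_left (nhdsWithin_le_nhds (s := Ioi 0))
    exact this.eventually (gt_mem_nhds (by simp))
  filter_upwards [Ioo_mem_nhdsGT hs, hsq] with ε ⟨hε, hεs⟩ hεC x hx
  rw [mem_closedBall_zero_iff] at hx
  -- Using the radius `‖x‖` instead of `ε`, with the origin as second point, makes the excess cubic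
  -- in `‖x‖`.
  have h1 := hlip ‖x‖ (norm_nonneg x) (hx.trans_lt hεs) x (by simp) 0 (by simp)
  rw [h.map_zero, sub_zero, sub_zero] at h1
  refine ⟨h.norm_le (mem_ball_zero_iff.2 (hx.trans_lt (hεs.trans_le hsr))), by linarith, ?_, ?_⟩
  · rw [div_le_iff₀ hε]; linarith
  · rw [div_le_iff₀ hε]
    have h2 : C * ‖x‖ ^ 2 ≤ C * ε ^ 2 := by gcongr
    calc ‖φ x‖ ≤ (1 + C * ‖x‖ ^ 2) * ‖x‖ := h1
      _ ≤ 2 * ε := by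
        gcongr
        linarith

lemma eventually_norm_profile_sub_le (h : IsLocalGraph M ι φ r) {w : ℝ → ℝ}
    (hw : IsRadialProfile w) {η : ℝ} (hη : 0 < η) :
    ∀ᶠ ε in 𝓝[>] (0 : ℝ), ∀ x ∈ Metric.closedBall 0 ε,
      ‖w (‖φ x‖ / ε) - w (‖x‖ / ε)‖ ≤ η * ε ^ 0 := by
  obtain ⟨C, hC, hφ⟩ := h.exists_norm_le
  obtain ⟨L, hL, hlip⟩ := hw.exists_lipschitz
  have hsq : ∀ᶠ ε in 𝓝[>] (0 : ℝ), L * (C * ε ^ 2) < η := by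
    have hc : Continuous fun ε : ℝ => L * (C * ε ^ 2) := by fun_prop
    have := (hc.tendsto 0).mono_left (nhdsWithin_le_nhds (s := Ioi 0))
    exact this.eventually (gt_mem_nhds (by simpa using hη))
  filter_upwards [hφ, hsq, self_mem_nhdsWithin] with ε hφε hsm hε x hx
  have hε' : (0 : ℝ) < ε := hε
  obtain ⟨h1, h2, h3, h4⟩ := hφε x hx
  rw [mem_closedBall_zero_iff] at hx
  rw [pow_zero, mul_one]
  refine le_trans (hlip _ _ (by positivity) h4 (by positivity) h3) (le_trans ?_ hsm.le)
  gcongr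
  rw [← sub_div, abs_of_nonneg (div_nonneg (sub_nonneg.2 h1) hε'.le), div_le_iff₀ hε']
  calc _ ≤ C * ‖x‖ ^ 3 := h2
    _ ≤ C * ε ^ 3 := by gcongr
    _ = _ := by ring

lemma eventually_norm_integrand_sub_le (h : IsLocalGraph M ι φ r) {w : ℝ → ℝ}
    (hw : IsRadialProfile w)
    {P : EuclideanSpace ℝ (Fin n) → EuclideanSpace ℝ (Fin n) →L[ℝ] EuclideanSpace ℝ (Fin n)}
    {c : ℝ} {b : EuclideanSpace ℝ (Fin d) →L[ℝ] EuclideanSpace ℝ (Fin d) →L[ℝ]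
      EuclideanSpace ℝ (Fin n)} (hP : HasQuadraticExpansion ι φ r P c b) {η : ℝ} (hη : 0 < η) :
    ∀ᶠ ε in 𝓝[>] (0 : ℝ), ∀ x ∈ Metric.closedBall 0 ε,
      ‖w (‖φ x‖ / ε) • P (φ x) (‖φ x‖⁻¹ • φ x) - modelIntegrand ι w c b ε x‖ ≤ η * ε ^ 1 := by
  obtain ⟨C, hC, hφ⟩ := h.exists_norm_le
  obtain ⟨L, hL, hlip⟩ := hw.exists_lipschitz
  obtain ⟨K, hK0, hK⟩ := hw.exists_bound
  set A := |c| + ‖b‖ with hA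
  have hA0 : 0 ≤ A := by positivity
  set η' := η / (2 * (K + 1)) with hη'
  have hη'0 : 0 < η' := by positivity
  have hsm : ∀ᶠ ε in 𝓝[>] (0 : ℝ), (L + K) * C * A * ε < η / 2 := by
    have hc : Continuous fun ε : ℝ => (L + K) * C * A * ε := by fun_prop
    have := (hc.tendsto 0).mono_left (nhdsWithin_le_nhds (s := Ioi 0))
    exact this.eventually (gt_mem_nhds (by simpa using hη))
  obtain ⟨δ, hδ, hball⟩ := Metric.eventually_nhds_iff_ball.1
    (Asymptotics.isLittleO_iff.1 hP.isLittleO hη'0)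
  filter_upwards [hφ, hsm, Ioo_mem_nhdsGT (lt_min hδ one_pos)] with ε hφε hsmε ⟨hε, hεδ⟩ x hx
  obtain ⟨h1, h2, h3, h4⟩ := hφε x hx
  rw [mem_closedBall_zero_iff] at hx
  have hxδ : ‖x‖ < δ := hx.trans_lt (hεδ.trans_le (min_le_left _ _))
  have hx1 : ‖x‖ ≤ 1 := hx.trans (hεδ.le.trans (min_le_right _ _))
  rw [pow_one]
  rcases eq_or_ne x 0 with rfl | hx0
  · have hz : w (‖φ 0‖ / ε) • P (φ 0) (‖φ 0‖⁻¹ • φ 0) - modelIntegrand ι w c b ε 0 = 0 := by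
      simp [h.map_zero, modelIntegrand]
    rw [hz, norm_zero]
    positivity
  have ht : 0 < ‖x‖ := norm_pos_iff.2 hx0
  have hT : 0 < ‖φ x‖ := ht.trans_le h1
  set q := c • ι x + b x x with hq
  have hqn : ‖q‖ ≤ A * ‖x‖ := norm_smul_add_bilin_le hx1
  have hF : ‖P (φ x) (φ x) - q‖ ≤ η' * ‖x‖ ^ 2 := by
    have := hball x (mem_ball_zero_iff.2 hxδ)
    rw [Real.norm_of_nonneg (by positivity : (0 : ℝ) ≤ ‖x‖ ^ 2), sub_sub] at this
    exact this
  -- Three errors are separated: the expansion of `P`, of size `K η' ε`; the argument of the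
  -- profile; and the normalization by the norm. The last two are `O(ε²)` because `‖φ x‖ - ‖x‖` is
  -- cubic.
  have hdecomp : w (‖φ x‖ / ε) • P (φ x) (‖φ x‖⁻¹ • φ x) - modelIntegrand ι w c b ε x =
      (w (‖φ x‖ / ε) * ‖φ x‖⁻¹) • (P (φ x) (φ x) - q) +
        ((w (‖φ x‖ / ε) - w (‖x‖ / ε)) * ‖φ x‖⁻¹) • q +
        (w (‖x‖ / ε) * (‖φ x‖⁻¹ - ‖x‖⁻¹)) • q := by
    rw [modelIntegrand, map_smul, ← hq]
    module
  have e1 : ‖(w (‖φ x‖ / ε) * ‖φ x‖⁻¹) • (P (φ x) (φ x) - q)‖ ≤ K * η' * ε := by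
    rw [norm_smul, norm_mul, norm_inv, norm_norm]
    calc _ ≤ K * ‖x‖⁻¹ * (η' * ‖x‖ ^ 2) := by
          gcongr
          exact hK _ (by positivity)
      _ = K * η' * ‖x‖ := by field_simp
      _ ≤ _ := by gcongr
  have e2 : ‖((w (‖φ x‖ / ε) - w (‖x‖ / ε)) * ‖φ x‖⁻¹) • q‖ ≤ L * C * A * ε ^ 2 := by
    rw [norm_smul, norm_mul, norm_inv, norm_norm]
    have h5 : ‖w (‖φ x‖ / ε) - w (‖x‖ / ε)‖ ≤ L * (C * ε ^ 2) := by
      refine le_trans (hlip _ _ (by positivity) h4 (by positivity) h3) ?_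
      gcongr
      rw [← sub_div, abs_of_nonneg (div_nonneg (sub_nonneg.2 h1) hε.le), div_le_iff₀ hε]
      calc _ ≤ C * ‖x‖ ^ 3 := h2
        _ ≤ C * ε ^ 3 := by gcongr
        _ = _ := by ring
    calc _ ≤ L * (C * ε ^ 2) * ‖x‖⁻¹ * (A * ‖x‖) := by gcongr
      _ = _ := by field_simp
  have e3 : ‖(w (‖x‖ / ε) * (‖φ x‖⁻¹ - ‖x‖⁻¹)) • q‖ ≤ K * C * A * ε ^ 2 := by
    rw [norm_smul, norm_mul]
    have h6 : ‖‖φ x‖⁻¹ - ‖x‖⁻¹‖ ≤ C * ‖x‖ := by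
      have : ‖φ x‖⁻¹ - ‖x‖⁻¹ = -((‖φ x‖ - ‖x‖) / (‖φ x‖ * ‖x‖)) := by
        field_simp
        ring
      rw [this, norm_neg, Real.norm_of_nonneg
        (div_nonneg (sub_nonneg.2 h1) (by positivity)), div_le_iff₀ (by positivity)]
      calc _ ≤ C * ‖x‖ ^ 3 := h2
        _ = C * ‖x‖ * (‖x‖ * ‖x‖) := by ring
        _ ≤ _ := by gcongr
    calc _ ≤ K * (C * ‖x‖) * (A * ‖x‖) := by
          gcongr
          exact hK _ (by positivity)
      _ = K * C * A * ‖x‖ ^ 2 := by ring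
      _ ≤ _ := by gcongr
  rw [hdecomp]
  refine (norm_add₃_le).trans ?_
  have hKη : K * η' ≤ η / 2 := by
    rw [hη']
    have : K * (η / (2 * (K + 1))) = η / 2 * (K / (K + 1)) := by field_simp
    rw [this]
    refine mul_le_of_le_one_right (by positivity) ?_
    rw [div_le_one (by positivity)]
    linarith
  calc _ ≤ K * η' * ε + L * C * A * ε ^ 2 + K * C * A * ε ^ 2 := by gcongr
    _ = K * η' * ε + ((L + K) * C * A * ε) * ε := by ring
    _ ≤ η / 2 * ε + η / 2 * ε := by gcongr
    _ = η * ε := by ring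

/-- Nothing is known about `P` away from the graph. On the graph, `y ↦ P y y` is a continuous
function of the projection of `y`, and linearity extracts the scalar `‖y‖⁻¹`. -/
lemma aestronglyMeasurable_integrand (h : IsLocalGraph M ι φ r) {w : ℝ → ℝ}
    (hw : IsRadialProfile w)
    {P : EuclideanSpace ℝ (Fin n) → EuclideanSpace ℝ (Fin n) →L[ℝ] EuclideanSpace ℝ (Fin n)}
    (hP : ContinuousOn (fun x => P (φ x) (φ x)) (Metric.ball 0 r)) {ε : ℝ} (hε : 0 < ε)
    (hεr : ε < r) (m : Measure (EuclideanSpace ℝ (Fin n))) :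
    AEStronglyMeasurable (fun y => w (‖y‖ / ε) • P y (‖y‖⁻¹ • y))
      (m.restrict (φ '' Metric.closedBall 0 ε)) := by
  have hsub := Metric.closedBall_subset_ball (x := (0 : EuclideanSpace ℝ (Fin d))) hεr
  have hmeas : MeasurableSet (φ '' Metric.closedBall 0 ε) :=
    ((isCompact_closedBall 0 ε).image_of_continuousOn (h.continuousOn.mono hsub)).measurableSet
  have hcont : ContinuousOn (fun y => P y y) (φ '' Metric.closedBall 0 ε) := by
    have h1 : ContinuousOn (fun y => P (φ (ι.toContinuousLinearMap.adjoint y))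
        (φ (ι.toContinuousLinearMap.adjoint y))) (φ '' Metric.closedBall 0 ε) := by
      refine hP.comp (ContinuousLinearMap.continuous _).continuousOn ?_
      rintro _ ⟨x, hx, rfl⟩
      rw [h.adjoint_apply x (hsub hx)]
      exact hsub hx
    refine h1.congr ?_
    rintro _ ⟨x, hx, rfl⟩
    simp only [h.adjoint_apply x (hsub hx)]
  simp only [map_smul]
  exact (hw.continuous_comp_norm hε).aestronglyMeasurable.smul
    (measurable_norm.inv.aestronglyMeasurable.smul (hcont.aestronglyMeasurable hmeas))

end IsLocalGraph

/-! ### Limits of the mass, the numerator and the approximate curvature -/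

namespace IsLocalGraph

variable {n d : ℕ} {M : Set (EuclideanSpace ℝ (Fin n))}
  {ι : EuclideanSpace ℝ (Fin d) →ₗᵢ[ℝ] EuclideanSpace ℝ (Fin n)}
  {φ : EuclideanSpace ℝ (Fin d) → EuclideanSpace ℝ (Fin n)} {r : ℝ}

lemma tendsto_mollifiedMass (h : IsLocalGraph M ι φ r) (hd : 1 ≤ d) {ξ : ℝ → ℝ}
    (hξ : IsKernel ξ) :
    Tendsto (fun ε => mollifiedMass d ξ (weightMeasure d M) 0 ε) (𝓝[>] 0)
      (𝓝 (kernelConst d ξ)) := by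
  have hw := hξ.isRadialProfile
  obtain ⟨K, hK0, hK⟩ := hw.exists_bound
  have hlim := (h.tendsto_integral_sub_integral (k := 0) zero_le_one
    (F := fun ε y => ξ (‖y‖ / ε)) (g := fun ε x => ξ (‖x‖ / ε)) hK0
    (fun ε hε y hy => hξ.supported _ ((one_lt_div hε).2 hy))
    (fun ε hε _ => (hw.continuous_comp_norm hε).aestronglyMeasurable)
    (fun ε hε => (hw.continuous_comp_norm hε).stronglyMeasurable)
    (fun ε hε x hx => hξ.supported _ ((one_lt_div hε).2 hx))
    (fun ε hε _ x => hK _ (by positivity))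
    (fun η hη => h.eventually_norm_profile_sub_le hw hη)).2
  have hlim' := hlim.add_const (kernelConst d ξ)
  rw [zero_add] at hlim'
  refine hlim'.congr' ?_
  filter_upwards [self_mem_nhdsWithin] with ε hε
  have hε' : (0 : ℝ) < ε := hε
  have hg : ∫ x : EuclideanSpace ℝ (Fin d), ξ (‖x‖ / ε) = ε ^ d * kernelConst d ξ := by
    have h1 := Measure.integral_comp_inv_smul_of_nonneg
      (volume : Measure (EuclideanSpace ℝ (Fin d))) (fun x => ξ ‖x‖) hε'.le
    rw [hξ.integral_norm hd, finrank_euclideanSpace_fin, smul_eq_mul] at h1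
    rw [← h1]
    simp only [norm_smul, norm_inv, Real.norm_of_nonneg hε'.le, div_eq_inv_mul]
  simp only [mollifiedMass, sub_zero, add_zero, hg, smul_eq_mul]
  field_simp
  ring

lemma tendsto_curvatureIntegral (h : IsLocalGraph M ι φ r) (hd : 1 ≤ d) {ρ : ℝ → ℝ}
    (hρ : IsKernel ρ)
    {P : EuclideanSpace ℝ (Fin n) → EuclideanSpace ℝ (Fin n) →L[ℝ] EuclideanSpace ℝ (Fin n)}
    {c : ℝ} {b : EuclideanSpace ℝ (Fin d) →L[ℝ] EuclideanSpace ℝ (Fin d) →L[ℝ]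
      EuclideanSpace ℝ (Fin n)} (hP : HasQuadraticExpansion ι φ r P c b) :
    (∀ᶠ ε in 𝓝[>] (0 : ℝ), Integrable (curvatureIntegrand ρ P 0 ε) (weightMeasure d M)) ∧
    Tendsto (fun ε => (ε ^ (d + 1))⁻¹ • ∫ y, curvatureIntegrand ρ P 0 ε y ∂(weightMeasure d M))
      (𝓝[>] 0) (𝓝 (-(kernelConst d ρ • ∑ i, b (EuclideanSpace.single i 1)
        (EuclideanSpace.single i 1)))) := by
  have hw := hρ.isRadialProfile_derivWithin
  obtain ⟨K, hK0, hK⟩ := hw.exists_bound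
  have hF : ∀ ε, curvatureIntegrand ρ P 0 ε =
      fun y => derivWithin ρ (Ici 0) (‖y‖ / ε) • P y (‖y‖⁻¹ • y) := by
    intro ε
    funext y
    simp only [curvatureIntegrand, sub_zero]
  obtain ⟨hint, hlim⟩ := h.tendsto_integral_sub_integral (k := 1) le_rfl
    (F := fun ε => curvatureIntegrand ρ P 0 ε)
    (g := fun ε => modelIntegrand ι (derivWithin ρ (Ici 0)) c b ε)
    (K := K * (|c| + ‖b‖)) (by positivity)
    (fun ε hε y hy => by
      simp only [hF]
      rw [hw.supported _ ((one_lt_div hε).2 hy), zero_smul])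
    (fun ε hε hεr => by
      simp only [hF]
      exact h.aestronglyMeasurable_integrand hw hP.continuousOn hε hεr _)
    (fun ε hε => stronglyMeasurable_modelIntegrand hw hε)
    (fun ε hε x hx => modelIntegrand_eq_zero hw hε hx)
    (fun ε hε hε1 x => norm_modelIntegrand_le hw hK0 hK hε hε1 x)
    (fun η hη => by
      simp only [hF]
      exact h.eventually_norm_integrand_sub_le hw hP hη)
  refine ⟨hint, ?_⟩
  have hlim' := hlim.add_const (-(kernelConst d ρ • ∑ i, b (EuclideanSpace.single i 1)
        (EuclideanSpace.single i 1)))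
  rw [zero_add] at hlim'
  refine hlim'.congr' ?_
  filter_upwards [Ioo_mem_nhdsGT (one_pos : (0 : ℝ) < 1)] with ε hε
  have hpow : ε ^ (d + 1) ≠ 0 := pow_ne_zero _ hε.1.ne'
  rw [integral_modelIntegrand hd hρ hε.1 hε.2.le, smul_sub, inv_smul_smul₀ hpow, sub_add_cancel]

lemma tendsto_approxMeanCurvature (h : IsLocalGraph M ι φ r) (hd : 1 ≤ d) {ρ ξ : ℝ → ℝ}
    (hρ : IsKernel ρ) (hξ : IsKernel ξ)
    {P : EuclideanSpace ℝ (Fin n) → EuclideanSpace ℝ (Fin n) →L[ℝ] EuclideanSpace ℝ (Fin n)}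
    {c : ℝ} {b : EuclideanSpace ℝ (Fin d) →L[ℝ] EuclideanSpace ℝ (Fin d) →L[ℝ]
      EuclideanSpace ℝ (Fin n)} (hP : HasQuadraticExpansion ι φ r P c b) :
    Tendsto (fun ε => approxMeanCurvature d ρ ξ (weightMeasure d M) P 0 ε) (𝓝[>] 0)
      (𝓝 (∑ i, b (EuclideanSpace.single i 1) (EuclideanSpace.single i 1))) := by
  have hCρ := (hρ.kernelConst_pos hd).ne'
  have hCξ := (hξ.kernelConst_pos hd).ne'
  have hlim := (((h.tendsto_mollifiedMass hd hξ).inv₀ hCξ).const_mul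
    (-(kernelConst d ξ / kernelConst d ρ))).smul (h.tendsto_curvatureIntegral hd hρ hP).2
  -- The minus sign in the definition cancels the one from integration by parts, and both kernel
  -- constants drop out.
  have hval : (-(kernelConst d ξ / kernelConst d ρ) * (kernelConst d ξ)⁻¹) •
      -(kernelConst d ρ • ∑ i, b (EuclideanSpace.single i 1) (EuclideanSpace.single i 1)) =
      ∑ i, b (EuclideanSpace.single i 1) (EuclideanSpace.single i 1) := by
    rw [smul_neg, ← neg_smul, smul_smul]
    have : -(-(kernelConst d ξ / kernelConst d ρ) * (kernelConst d ξ)⁻¹) * kernelConst d ρ = 1 := by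
      field_simp
    rw [this, one_smul]
  rw [hval] at hlim
  refine hlim.congr' ?_
  filter_upwards [self_mem_nhdsWithin] with ε hε
  have hε' : (0 : ℝ) < ε := hε
  rw [approxMeanCurvature, smul_smul, smul_smul]
  congr 1
  rw [mul_inv, pow_succ, mul_inv, div_mul_eq_div_div]
  ring

lemma meanCurvature_eq (h : IsLocalGraph M ι φ r)
    (hH : meanCurvature M 0 = ∑ i, secondFundForm M 0 (ι (EuclideanSpace.single i 1))
      (ι (EuclideanSpace.single i 1))) :
    meanCurvature M 0 = ∑ i, (projDeriv M φ).bilinearComp (ContinuousLinearMap.id ℝ _)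
      ι.toContinuousLinearMap (EuclideanSpace.single i 1) (EuclideanSpace.single i 1) := by
  rw [hH]
  refine Finset.sum_congr rfl fun i _ => ?_
  rw [h.secondFundForm_eq]
  rfl

end IsLocalGraph

theorem proposition2p2 {n d : ℕ} (hd : 1 ≤ d) (M : Set (EuclideanSpace ℝ (Fin n)))
    (hM : IsC2Submanifold d M) (h0 : (0 : EuclideanSpace ℝ (Fin n)) ∈ M)
    (ρ ξ : ℝ → ℝ) (hρ : IsKernel ρ) (hξ : IsKernel ξ) :
    (∀ᶠ ε in 𝓝[>] (0 : ℝ), 0 < mollifiedMass d ξ (weightMeasure d M) 0 ε) ∧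
    (∀ P ∈ ({fun y => (2 : ℝ) • (norProj M y ∘L norProj M 0),
             fun y => tanProj M y ∘L tanProj M 0,
             fun y => -(norProj M y ∘L tanProj M 0)} :
          Set (EuclideanSpace ℝ (Fin n) →
            EuclideanSpace ℝ (Fin n) →L[ℝ] EuclideanSpace ℝ (Fin n))),
        (∀ᶠ ε in 𝓝[>] (0 : ℝ), Integrable (curvatureIntegrand ρ P 0 ε) (weightMeasure d M)) ∧
        Tendsto (fun ε => approxMeanCurvature d ρ ξ (weightMeasure d M) P 0 ε)
          (𝓝[>] 0) (𝓝 (meanCurvature M 0))) ∧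
    (∀ P ∈ ({fun _ => tanProj M 0,
             fun y => tanProj M 0 ∘L tanProj M y,
             fun y => tanProj M y ∘L norProj M 0,
             fun y => tanProj M 0 ∘L norProj M y} :
          Set (EuclideanSpace ℝ (Fin n) →
            EuclideanSpace ℝ (Fin n) →L[ℝ] EuclideanSpace ℝ (Fin n))),
        (∀ᶠ ε in 𝓝[>] (0 : ℝ), Integrable (curvatureIntegrand ρ P 0 ε) (weightMeasure d M)) ∧
        Tendsto (fun ε => approxMeanCurvature d ρ ξ (weightMeasure d M) P 0 ε)
          (𝓝[>] 0) (𝓝 0)) := by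
  obtain ⟨ι, hι, hH⟩ := hM.exists_linearIsometry h0
  obtain ⟨φ, r, h⟩ := hM.exists_isLocalGraph h0 ι hι
  refine ⟨(h.tendsto_mollifiedMass hd hξ).eventually (lt_mem_nhds (hξ.kernelConst_pos hd)), ?_, ?_⟩
  · rw [h.meanCurvature_eq hH]
    rintro P (rfl | rfl | rfl)
    · have hP := h.hasQuadraticExpansion_norProj_norProj
      exact ⟨(h.tendsto_curvatureIntegral hd hρ hP).1,
        h.tendsto_approxMeanCurvature hd hρ hξ hP⟩
    · have hP := h.hasQuadraticExpansion_tanProj_tanProj_zero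
      exact ⟨(h.tendsto_curvatureIntegral hd hρ hP).1,
        h.tendsto_approxMeanCurvature hd hρ hξ hP⟩
    · have hP := h.hasQuadraticExpansion_neg_norProj_tanProj_zero
      exact ⟨(h.tendsto_curvatureIntegral hd hρ hP).1,
        h.tendsto_approxMeanCurvature hd hρ hξ hP⟩
  · have hzero : ∀ {P c}, HasQuadraticExpansion ι φ r P c 0 →
        (∀ᶠ ε in 𝓝[>] (0 : ℝ), Integrable (curvatureIntegrand ρ P 0 ε) (weightMeasure d M)) ∧
        Tendsto (fun ε => approxMeanCurvature d ρ ξ (weightMeasure d M) P 0 ε)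
          (𝓝[>] 0) (𝓝 0) := fun hP =>
      ⟨(h.tendsto_curvatureIntegral hd hρ hP).1, by
        simpa using h.tendsto_approxMeanCurvature hd hρ hξ hP⟩
    rintro P (rfl | rfl | rfl | rfl)
    · exact hzero h.hasQuadraticExpansion_tanProj_zero
    · exact hzero h.hasQuadraticExpansion_tanProj_zero_tanProj
    · exact hzero h.hasQuadraticExpansion_tanProj_norProj_zero
    · exact hzero h.hasQuadraticExpansion_tanProj_zero_norProj
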